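/- **Setting.** Examples are pairs $(x,y)\in\{-1,1\}^d\times\{-1,1\}$, $\operatorname{sgn}(z)=1$ if $z\ge 0$ and $-1$ otherwise, $\log$ is the natural logarithm. A sequence $S=((x^{(1)},y^{(1)}),\dots,(x^{(T)},y^{(T)}))$ is *consistent with a $\rho$-margin halfspace* if there is $v\in\mathbb R^d$ with $v\ge 0$, $\|v\|_1=1$ and $y^{(t)}\langle v,x^{(t)}\rangle\ge\rho$ for all $t$. A randomized map $M$ on sequences of length $T$ is $(\varepsilon,\delta)$-differentially private if $\Pr[M(S)\in R]\le e^{\varepsilon}\Pr[M(S')\in R]+\delta$ for all $S,S'$ that differ in a single example and all sets $R$ of outputs. **Algorithm DP-Winnow** (parameters $T,K,\hat\varepsilon,\eta,L,m$). Start with $k=0$, an empty cache $C$, $w=\tilde w=(1/d,\dots,1/d)$, and noisy threshold $\theta=L+\mathrm{Lap}(2/\hat\varepsilon)$. In each round $t=1,\dots,T$: 1. release the hypothesis $\tilde w^{(t)}=\tilde w$, which stands for the halfspace $x\mapsto\operatorname{sgn}\langle\tilde w,x\rangle$, and observe $(x^{(t)},y^{(t)})$; 2. if $\operatorname{sgn}\langle\tilde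 w,x^{(t)}\rangle\ne y^{(t)}$ (a prediction error), append $(x^{(t)},y^{(t)})$ to $C$; 3. if $|C|+\mathrm{Lap}(4/\hat\varepsilon)\ge\theta$ (the AboveThreshold test for the number of errors since the last update) and $k<K$, then: let $(\hat x,\hat y)$ be the first element of $C$ and replace each $w_j$ by $w_je^{\eta\hat y\hat x_j}/\sum_i w_ie^{\eta\hat y\hat x_i}$ (if $C$ is empty, keep $w$); draw $j_1,\dots,j_m$ i.i.d. from the distribution $w$ and set $\tilde w_j=\frac1m\#\{i:j_i=j\}$; increase $k$ by one, empty $C$, and draw a new $\theta=L+\mathrm{Lap}(2/\hat\varepsilon)$. All Laplace variables are fresh and independent, also of the sampling. **Theorem.** There are absolute constants $C_0>0$ and $p\in\mathbb N$ such that the following holds for all integers $d\ge2$, $T\ge1$ and all $\rho\in(0,1]$, $\varepsilon,\delta,\beta\in(0,1)$. Put $m=\lceil 8\log(2T/\beta)/\rho^2\rceil$. The system $$K=\frac{2\log d}{\eta\rho-\eta^2},\qquad \eta=\frac{\varepsilon}{8\sqrt{2mK\log(4K/\delta)}}$$ has a solution with $K,\eta>0$. For every such solution, with $$\hat\varepsilon=\frac{\varepsilon}{4\sqrt{2K\log(2/\delta)}},\qquad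 L=\frac{8\log(2T/\beta)}{\hat\varepsilon},$$ DP-Winnow has the following two properties. * The map that takes $S$ to the released sequence $\tilde w^{(1)},\dots,\tilde w^{(T)}$ is $(\varepsilon,\delta)$-differentially private (on all sequences $S$, realizable or not). * For every sequence $S$, fixed in advance (oblivious adversary), that is consistent with a $\rho$-margin halfspace, the number of prediction errors is, with probability at least $1-2\beta$, at most $$C_0\,f\,\bigl(\log(2+f)\bigr)^p,\qquad f=\frac{\log^3 d\cdot\log^{5/2}(T/\beta)\cdot\log^2(2/\delta)}{\varepsilon^4\rho^6},$$ that is, at most $\tilde O\Bigl(\frac{\log^3 d\,\cdot\,\log^{5/2}(T/\beta)\,\cdot\,\log^2(1/\delta)}{\varepsilon^4\rho^6}\Bigr)$ when $\delta$ is bounded away from $1$. -/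

import Mathlib

open MeasureTheory

noncomputable section

namespace DPWinnow

/-- A labeled example: a point of the cube `{-1, 1}^d` with a label in `{-1, 1}`. -/
abbrev Example (d : ℕ) : Type := (Fin d → ℤˣ) × ℤˣ

/-- The inner product of a real weight vector with a point of `{-1, 1}^d`. -/
def dot {d : ℕ} (w : Fin d → ℝ) (x : Fin d → ℤˣ) : ℝ :=
  ∑ j, w j * ((x j : ℤ) : ℝ)

/-- The halfspace `x ↦ sgn ⟨w, x⟩` with values in `{-1, 1}` (and `sgn 0 = 1`). -/
def predict {d : ℕ} (w : Fin d → ℝ) (x : Fin d → ℤˣ) : ℤˣ :=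
  if 0 ≤ dot w x then 1 else -1

/-- The sequence is labeled by a halfspace with nonnegative weights `v`, `‖v‖₁ = 1`,
with margin at least `ρ` on every example. -/
def MarginConsistent {d T : ℕ} (ρ : ℝ) (S : Fin T → Example d) : Prop :=
  ∃ v : Fin d → ℝ, (∀ j, 0 ≤ v j) ∧ ∑ j, |v j| = 1 ∧
    ∀ t, ρ ≤ (((S t).2 : ℤ) : ℝ) * dot v (S t).1

/-! ### Differential privacy -/

/-- Two sequences that differ in at most one entry. -/
def Neighboring {T : ℕ} {Z : Type*} (S S' : Fin T → Z) : Prop :=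
  ∃ i, ∀ j, j ≠ i → S j = S' j

/-- `(ε, δ)`-differential privacy of a randomized algorithm `M`, whose internal randomness is
a point of the probability space `(Ω, μ)`. -/
def IsDP {T : ℕ} {Z Ω H : Type*} [MeasurableSpace Ω] (μ : Measure Ω) (ε δ : ℝ)
    (M : (Fin T → Z) → Ω → H) : Prop :=
  ∀ S S' : Fin T → Z, Neighboring S S' → ∀ R : Set H,
    μ.real {ω | M S ω ∈ R} ≤ Real.exp ε * μ.real {ω | M S' ω ∈ R} + δ

/-! ### The internal randomness -/

/-- The Laplace distribution with mean `0` and scale `b > 0`. -/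
def laplace (b : ℝ) : Measure ℝ :=
  volume.withDensity fun x => ENNReal.ofReal (Real.exp (-(|x| / b)) / (2 * b))

/-- All the random numbers of a run over `T` rounds. -/
abbrev Noise (T m : ℕ) : Type :=
  (Fin (T + 1) → ℝ) × (Fin T → ℝ) × (Fin T → Fin m → ℝ)

/-- Threshold noise: entry `0` is for the initial instance of `AboveThreshold`, entry `t + 1`
for an instance created at the end of round `t`. -/
def Noise.thr {T m : ℕ} (ω : Noise T m) : Fin (T + 1) → ℝ := ω.1

/-- Query noise, one number for each round. -/
def Noise.query {T m : ℕ} (ω : Noise T m) : Fin T → ℝ := ω.2.1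

/-- The uniform numbers from which the `m` indices of round `t` are sampled. -/
def Noise.unif {T m : ℕ} (ω : Noise T m) : Fin T → Fin m → ℝ := ω.2.2

/-- All random numbers are independent. The threshold noise is Laplace of scale `2 / εhat`, the
query noise Laplace of scale `4 / εhat`, the remaining numbers are uniform on `[0, 1]`. -/
def noiseLaw (T m : ℕ) (εhat : ℝ) : Measure (Noise T m) :=
  (Measure.pi fun _ : Fin (T + 1) => laplace (2 / εhat)).prod
    ((Measure.pi fun _ : Fin T => laplace (4 / εhat)).prod
      (Measure.pi fun _ : Fin T => Measure.pi fun _ : Fin m =>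
        (volume : Measure ℝ).restrict (Set.Icc 0 1)))

/-! ### The algorithm -/

/-- The inputs of the algorithm that influence its run: privacy parameter of `AboveThreshold`,
learning rate, threshold, number of samples, switching bound. -/
structure Params where
  εhat : ℝ
  η : ℝ
  L : ℝ
  m : ℕ
  K : ℝ

/-- Multiplicative weights update of `w` with the example `e`. -/
def mwUpdate {d : ℕ} (η : ℝ) (w : Fin d → ℝ) (e : Example d) : Fin d → ℝ := fun j =>
  Real.exp (η * ((e.2 : ℤ) : ℝ) * ((e.1 j : ℤ) : ℝ)) /
    (∑ k, w k * Real.exp (η * ((e.2 : ℤ) : ℝ) * ((e.1 k : ℤ) : ℝ))) * w j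

/-- The number `u ∈ [0, 1]` selects the index `j`. If `w` is a probability vector, these are
consecutive intervals of lengths `w j`, so that a uniform `u` selects `j` with
probability `w j`. -/
def Selects {d : ℕ} (w : Fin d → ℝ) (u : ℝ) (j : Fin d) : Prop :=
  ∑ k ∈ Finset.univ.filter (· < j), w k ≤ u ∧ u < ∑ k ∈ Finset.univ.filter (· ≤ j), w k

open Classical in
/-- The empirical distribution of the `m` indices selected by `u` from the distribution `w`. -/
def empirical {d m : ℕ} (w : Fin d → ℝ) (u : Fin m → ℝ) : Fin d → ℝ := fun j =>
  1 / (m : ℝ) * ((Finset.univ.filter fun i => Selects w (u i) j).card : ℝ)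

/-- The state of the learner between two rounds. -/
structure LState (d : ℕ) where
  /-- number of updates so far -/
  k : ℕ
  /-- the cache `C` of the prediction errors since the last update, oldest first -/
  cache : List (Example d)
  /-- the (private) weight vector -/
  w : Fin d → ℝ
  /-- the (released) approximate weight vector -/
  wt : Fin d → ℝ
  /-- the noisy threshold of the current instance of `AboveThreshold` -/
  thr : ℝ

/-- The initial state. -/
def initState (d : ℕ) {T m : ℕ} (L : ℝ) (ω : Noise T m) : LState d where
  k := 0
  cache := []
  w := fun _ => 1 / (d : ℝ)
  wt := fun _ => 1 / (d : ℝ)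
  thr := L + ω.thr 0

open Classical in
/-- What happens in round `t`, after the hypothesis `s.wt` has been released and the example
`e` has been revealed. The query is the number of errors since the last update, that is, the
length of the cache. `AboveThreshold` answers positively if the query plus fresh Laplace noise
is at least the noisy threshold. If that happens with an empty cache, there is no example
to update with and the private weights stay as they are. -/
def step {d T : ℕ} (P : Params) (ω : Noise T P.m) (e : Example d) (t : Fin T)
    (s : LState d) : LState d :=
  let C := if predict s.wt e.1 ≠ e.2 then s.cache ++ [e] else s.cache
  if s.thr ≤ (C.length : ℝ) + ω.query t ∧ (s.k : ℝ) < P.K then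
    let w' := match C.head? with
      | some c => mwUpdate P.η s.w c
      | none => s.w
    { k := s.k + 1
      cache := []
      w := w'
      wt := empirical w' (ω.unif t)
      thr := P.L + ω.thr t.succ }
  else { s with cache := C }

/-- The state before round `t` (after the last round, if `t = T`). -/
def stateAt {d T : ℕ} (P : Params) (S : Fin T → Example d) (ω : Noise T P.m)
    (t : Fin (T + 1)) : LState d :=
  Fin.induction (motive := fun _ => LState d) (initState d P.L ω)
    (fun r s => step P ω (S r) r s) t

/-- DP-Winnow: the released sequence of weight vectors, on the example sequence `S` and
with the random numbers `ω`. -/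
def hypotheses {d T : ℕ} (P : Params) (S : Fin T → Example d) (ω : Noise T P.m) :
    Fin T → Fin d → ℝ :=
  fun t => (stateAt P S ω t.castSucc).wt

/-- The number of prediction errors of a run. -/
def errors {d T : ℕ} (P : Params) (S : Fin T → Example d) (ω : Noise T P.m) : ℕ :=
  (Finset.univ.filter fun t => predict (hypotheses P S ω t) (S t).1 ≠ (S t).2).card

/-! ### The choice of parameters -/

/-- The parameters of the theorem. The equations for `K` and `η` refer to each other. -/
structure Admissible (d T : ℕ) (ρ ε δ β : ℝ) (P : Params) : Prop where
  K_pos : 0 < P.K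
  η_pos : 0 < P.η
  m_eq : P.m = ⌈8 * Real.log (2 * T / β) / ρ ^ 2⌉₊
  K_eq : P.K = 2 * Real.log d / (P.η * ρ - P.η ^ 2)
  η_eq : P.η = ε / (8 * Real.sqrt (2 * P.m * P.K * Real.log (4 * P.K / δ)))
  εhat_eq : P.εhat = ε / (4 * Real.sqrt (2 * P.K * Real.log (2 / δ)))
  L_eq : P.L = 8 * Real.log (2 * T / β) / P.εhat

/-- The main term of the error bound. -/
def mainTerm (d T : ℕ) (ρ ε δ β : ℝ) : ℝ :=
  Real.log d ^ 3 * Real.log (T / β) ^ (5 / 2 : ℝ) * Real.log (2 / δ) ^ 2 / (ε ^ 4 * ρ ^ 6)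

end DPWinnow

end

open MeasureTheory

noncomputable section

namespace DPWinnow

/-! Transcripts. Record for each round whether an update happens and, if so, which indices are
sampled. For fixed examples the transcript determines caches, private weights and released
hypotheses (`stateAt_eq_trun`). Its probability is the product of `testLaw` of `testSet`, which
involves only the Laplace noise, and `pathProb`, the probability of the samples. Both claims thus
become finite sums over transcripts, and the adaptive sampling is controlled by one supermartingale
inequality, `sum_chain_le`.

Privacy. Let two sequences differ in round `i` and compare them on the same transcript. The released
hypotheses agree, so outside round `i` the same errors occur; since an update empties the cache, the
error counts differ only within one epoch (the span between consecutive updates), and by at most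
one. Shifting the threshold noise of that epoch by 1 and the query noise of its update by 2 costs a
factor `exp εhat` (`testLaw_testSet_le`); no composition over epochs is needed. Only the update
ending that epoch can use different examples, so afterwards the two weight vectors differ by a
normalized factor `exp (η h)` with `|h| ≤ 2` (`Tilt`). Hoeffding's lemma bounds the `l`-th moment of
the likelihood ratio of one sample by `exp (2 η² l (l + 1))`, and the chain inequality multiplies
this over `m` samples in each of at most `⌈K⌉` updates (`sum_indicator_ratio_le`). A Markov-type
inequality then gives `(ε, δ)` (`isDP_hypotheses`).

Errors. With probability at least `1 - 3β/2` all Laplace variables are moderate. Then no update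
happens with an empty cache, and before the budget `K` is exhausted a cache never holds more than
`14 log (2T/β) / εhat` errors between rounds, which bounds the errors by about `K` times this number
(`errors_le`). To exhaust the budget, multiplicative weights would have to make too little progress
towards the target `v`. An update on an example with private margin at most `ρ/2` gains at least
`(ηρ - η²)/2` in `crossLog`, which rises from `-log d` and never exceeds 0. A sampled hypothesis
that errs although the private margin is larger is a Hoeffding deviation. An exponential potential
charges this deviation exactly against the lost progress, so exhaustion has probability at most `T
exp (-mρ²/8) ≤ β/2`, without a factor for the number of updates.

Parameters. The implicit equations are solved by the intermediate value theorem
(`exists_admissible`); `budget_le_mainTerm` removes the self-reference in `K` at the cost of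
logarithms. -/

/-! ### Finite averages -/

/-- Hoeffding's lemma for a probability vector. -/
theorem sum_mul_exp_le {ι : Type*} [Fintype ι] {w : ι → ℝ} (hw : ∀ j, 0 ≤ w j)
    (hw1 : ∑ j, w j = 1) {f : ι → ℝ} {b : ℝ} (hf : ∀ j, |f j| ≤ b) (t : ℝ) :
    ∑ j, w j * Real.exp (t * f j) ≤
      Real.exp (t * ∑ j, w j * f j + b ^ 2 * t ^ 2 / 2) := by
  classical
  let : MeasurableSpace ι := ⊤
  let p : PMF ι := PMF.ofFintype (fun j => ENNReal.ofReal (w j)) (by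
    rw [← ENNReal.ofReal_sum_of_nonneg fun j _ => hw j, hw1, ENNReal.ofReal_one])
  have key : ∀ g : ι → ℝ, ∫ j, g j ∂p.toMeasure = ∑ j, w j * g j := fun g => by
    rw [PMF.integral_eq_sum]
    refine Finset.sum_congr rfl fun j _ => ?_
    simp [p, ENNReal.toReal_ofReal (hw j)]
  have hs := ProbabilityTheory.hasSubgaussianMGF_of_mem_Icc (μ := p.toMeasure) (X := f)
    (a := -b) (b := b) (measurable_from_top).aemeasurable
    (Filter.Eventually.of_forall fun j => abs_le.1 (hf j))
  have h := hs.mgf_le t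
  rw [ProbabilityTheory.mgf, key, key] at h
  -- The sub-Gaussian parameter is the squared half-length of the interval `[-b, b]`.
  have hb : ((‖b - -b‖₊ / 2) ^ 2 : NNReal) = b ^ 2 := by
    push_cast
    rw [Real.norm_eq_abs, div_pow, sq_abs]
    ring
  rw [hb] at h
  have e : ∀ j, Real.exp (t * f j) =
      Real.exp (t * ∑ j, w j * f j) * Real.exp (t * (f j - ∑ j, w j * f j)) := fun j => by
    rw [← Real.exp_add]; ring_nf
  rw [Real.exp_add]
  calc ∑ j, w j * Real.exp (t * f j)
      = Real.exp (t * ∑ j, w j * f j) *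
          ∑ j, w j * Real.exp (t * (f j - ∑ j, w j * f j)) := by
        rw [Finset.mul_sum]
        refine Finset.sum_congr rfl fun j _ => ?_
        rw [e j]; ring
    _ ≤ _ := mul_le_mul_of_nonneg_left h (Real.exp_pos _).le

/-- If the coefficients `c i` selected by any point of `G` sum up to at most `C`, then the
average over `G` of the selected sum is at most `C`. -/
theorem sum_measureReal_inter_mul_le {α ι : Type*} [MeasurableSpace α] [Fintype ι]
    (ζ : Measure α) [IsFiniteMeasure ζ] {A : ι → Set α} (hA : ∀ i, MeasurableSet (A i))
    {G : Set α} (hG : MeasurableSet G) (c : ι → ℝ) (C : ℝ)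
    (h : ∀ z ∈ G, ∑ i, (A i).indicator (fun _ => c i) z ≤ C) :
    ∑ i, ζ.real (A i ∩ G) * c i ≤ C * ζ.real G := by
  have h1 : ∀ i, ζ.real (A i ∩ G) * c i = ∫ z in G, (A i).indicator (fun _ => c i) z ∂ζ := by
    intro i
    rw [integral_indicator_const _ (hA i), measureReal_restrict_apply (hA i), smul_eq_mul]
  have h2 : ∀ i, Integrable ((A i).indicator fun _ => c i) (ζ.restrict G) := fun i =>
    (integrable_const _).indicator (hA i)
  simp_rw [h1]
  rw [← integral_finsetSum _ fun i _ => h2 i]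
  calc _ ≤ ∫ z in G, C ∂ζ := setIntegral_mono_on
        (integrable_finsetSum _ fun i _ => h2 i) (integrable_const _) hG h
    _ = _ := by simp [mul_comm]

/-! ### The Laplace distribution -/

theorem measurable_laplace_density (b : ℝ) : Measurable fun x : ℝ =>
    ENNReal.ofReal (Real.exp (-(|x| / b)) / (2 * b)) := by fun_prop

theorem integral_laplace_tail {b c : ℝ} (hb : 0 < b) :
    ∫ x in Set.Ioi c, Real.exp (-(x / b)) / (2 * b) = Real.exp (-(c / b)) / 2 := by
  have h := integral_exp_mul_Ioi (a := -(1 / b)) (by simpa using hb) c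
  have e : ∀ x : ℝ, Real.exp (-(x / b)) / (2 * b) = (2 * b)⁻¹ * Real.exp (-(1 / b) * x) := by
    intro x; rw [show -(x / b) = -(1 / b) * x by ring]; ring
  simp_rw [e]
  rw [integral_const_mul, h, show -(1 / b) * c = -(c / b) by ring]
  field_simp

theorem integrable_laplace_tail {b : ℝ} (hb : 0 < b) (c : ℝ) :
    IntegrableOn (fun x => Real.exp (-(x / b)) / (2 * b)) (Set.Ioi c) := by
  have h := integrableOn_exp_mul_Ioi (a := -(1 / b)) (by simpa using hb) c
  refine IntegrableOn.congr_fun (Integrable.const_mul h (2 * b)⁻¹) (fun x _ => ?_) measurableSet_Ioi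
  rw [show -(x / b) = -(1 / b) * x by ring]; ring

theorem laplace_Ioi {b c : ℝ} (hb : 0 < b) (hc : 0 ≤ c) :
    laplace b (Set.Ioi c) = ENNReal.ofReal (Real.exp (-(c / b)) / 2) := by
  rw [laplace, withDensity_apply _ measurableSet_Ioi, ← integral_laplace_tail hb,
    ofReal_integral_eq_lintegral_ofReal (integrable_laplace_tail hb c)
      (Filter.Eventually.of_forall fun x => by positivity)]
  refine setLIntegral_congr_fun measurableSet_Ioi fun x hx => ?_
  rw [abs_of_nonneg (hc.trans (le_of_lt hx))]

theorem laplace_neg (b : ℝ) {A : Set ℝ} (hA : MeasurableSet A) :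
    laplace b (-A) = laplace b A := by
  have h := (Measure.measurePreserving_neg (volume : Measure ℝ)).setLIntegral_comp_preimage hA
    (measurable_laplace_density b)
  rw [laplace, withDensity_apply _ hA, withDensity_apply _ hA.neg, ← h]
  simp only [abs_neg]
  rfl

theorem laplace_abs_gt {b c : ℝ} (hb : 0 < b) (hc : 0 ≤ c) :
    laplace b {x | c < |x|} = ENNReal.ofReal (Real.exp (-(c / b))) := by
  have e : {x : ℝ | c < |x|} = Set.Ioi c ∪ -Set.Ioi c := by
    ext x; simp [lt_abs, lt_neg]
  rw [e, measure_union _ measurableSet_Ioi.neg, laplace_neg _ measurableSet_Ioi, laplace_Ioi hb hc,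
    ← ENNReal.ofReal_add (by positivity) (by positivity)]
  · ring_nf
  · rw [Set.disjoint_left]
    intro x hx hx'
    simp only [Set.mem_Ioi, Set.mem_neg] at hx hx'
    linarith

theorem isProbabilityMeasure_laplace {b : ℝ} (hb : 0 < b) :
    IsProbabilityMeasure (laplace b) := by
  constructor
  have h0 : laplace b {0} = 0 := by
    rw [laplace]
    exact withDensity_absolutelyContinuous _ _ (measure_singleton 0)
  have e : (Set.univ : Set ℝ) = {0} ∪ {x | 0 < |x|} := by
    ext x; simp [em]
  refine le_antisymm ?_ ?_
  · rw [e]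
    refine (measure_union_le _ _).trans ?_
    rw [h0, laplace_abs_gt hb le_rfl]; simp
  · have := measure_mono (μ := laplace b) (Set.subset_univ {x : ℝ | 0 < |x|})
    rw [laplace_abs_gt hb le_rfl] at this
    simpa using this

/-- Shifting the Laplace distribution of scale `b` by `a` changes probabilities by a factor of
at most `exp (a / b)`. -/
theorem lintegral_laplace_add_le {b a : ℝ} (hb : 0 < b) (ha : 0 ≤ a) {f : ℝ → ENNReal}
    (hf : Measurable f) :
    ∫⁻ x, f (x + a) ∂laplace b ≤
      ENNReal.ofReal (Real.exp (a / b)) * ∫⁻ x, f x ∂laplace b := by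
  have hd := measurable_laplace_density b
  rw [laplace, lintegral_withDensity_eq_lintegral_mul _ hd hf,
    lintegral_withDensity_eq_lintegral_mul _ hd (by fun_prop),
    ← lintegral_const_mul _ (hd.mul hf)]
  rw [← lintegral_add_right_eq_self (μ := (volume : Measure ℝ)) (fun x =>
    ENNReal.ofReal (Real.exp (a / b)) * ((fun x : ℝ =>
    ENNReal.ofReal (Real.exp (-(|x| / b)) / (2 * b))) * f) x) a]
  refine lintegral_mono fun x => ?_
  simp only [Pi.mul_apply]
  rw [← mul_assoc]
  refine mul_le_mul_left ?_ _
  rw [← ENNReal.ofReal_mul (Real.exp_pos _).le]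
  refine ENNReal.ofReal_le_ofReal ?_
  rw [← mul_div_assoc, ← Real.exp_add]
  refine div_le_div_of_nonneg_right (Real.exp_le_exp.2 ?_) (by positivity)
  have : |x + a| ≤ |x| + a := (abs_add_le _ _).trans (by rw [abs_of_nonneg ha])
  have h2 : |x + a| / b ≤ (|x| + a) / b := div_le_div_of_nonneg_right this hb.le
  rw [add_div] at h2
  linarith

/-- Shifting one coordinate of a vector of independent Laplace variables. -/
theorem lintegral_pi_laplace_update_le {ι : Type*} [Fintype ι] [DecidableEq ι] {b a : ℝ}
    (hb : 0 < b) (ha : 0 ≤ a) (i : ι) {f : (ι → ℝ) → ENNReal} (hf : Measurable f) :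
    ∫⁻ x, f (Function.update x i (x i + a)) ∂(Measure.pi fun _ : ι => laplace b) ≤
      ENNReal.ofReal (Real.exp (a / b)) *
        ∫⁻ x, f x ∂(Measure.pi fun _ : ι => laplace b) := by
  have := isProbabilityMeasure_laplace hb
  have hu : Measurable fun x : ι → ℝ => Function.update x i (x i + a) := by fun_prop
  rw [← lintegral_const_mul _ hf]
  -- Integrating coordinate `i` alone already gives the inequality, for all values of the others.
  refine lintegral_le_of_lmarginal_le {i} (hf.comp hu) (hf.const_mul _) fun x => ?_
  simp only [lmarginal_singleton]
  have h := lintegral_laplace_add_le hb ha (f := fun y => f (Function.update x i y))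
    (by fun_prop)
  rw [lintegral_const_mul _ (by fun_prop)]
  simpa using h

/-! ### Controlled chains -/

/-- The state before step `t` of the deterministic system `F` driven by the inputs `τ`. -/
def chain {σ O : Type*} {T : ℕ} (F : Fin T → σ → O → σ) (s₀ : σ) (τ : Fin T → O)
    (t : Fin (T + 1)) : σ :=
  Fin.induction (motive := fun _ => σ) s₀ (fun r s => F r s (τ r)) t

@[simp] theorem chain_zero {σ O : Type*} {T : ℕ} (F : Fin T → σ → O → σ) (s₀ : σ)
    (τ : Fin T → O) : chain F s₀ τ 0 = s₀ := rfl

theorem chain_succ {σ O : Type*} {T : ℕ} (F : Fin T → σ → O → σ) (s₀ : σ)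
    (τ : Fin T → O) (t : Fin T) :
    chain F s₀ τ t.succ = F t (chain F s₀ τ t.castSucc) (τ t) := rfl

theorem chain_cons {σ O : Type*} {T : ℕ} (F : Fin (T + 1) → σ → O → σ) (s₀ : σ) (o : O)
    (τ : Fin T → O) (t : Fin (T + 1)) :
    chain F s₀ (Fin.cons o τ : Fin (T + 1) → O) t.succ =
      chain (fun r => F r.succ) (F 0 s₀ o) τ t := by
  induction t using Fin.induction with
  | zero => rfl
  | succ t ih =>
    rw [chain_succ, chain_succ, ← ih, Fin.cons_succ, Fin.succ_castSucc]

theorem chain_inv {σ O : Type*} {T : ℕ} {F : Fin T → σ → O → σ} {s₀ : σ} {τ : Fin T → O}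
    (Inv : Fin (T + 1) → σ → Prop) (h0 : Inv 0 s₀)
    (h : ∀ t s, s = chain F s₀ τ t.castSucc → Inv t.castSucc s → Inv t.succ (F t s (τ t)))
    (t : Fin (T + 1)) : Inv t (chain F s₀ τ t) := by
  induction t using Fin.induction with
  | zero => exact h0
  | succ t ih => exact h t _ rfl ih

/-- If `Φ` does not increase on average in any step of a chain with transition weights `κ`, then
its final average is at most its initial value. -/
theorem sum_chain_le {σ O : Type*} [Fintype O] {T : ℕ} (F : Fin T → σ → O → σ)
    (κ : Fin T → σ → O → ℝ) (Φ : Fin (T + 1) → σ → ℝ) (Inv : Fin (T + 1) → σ → Prop)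
    (hκ : ∀ t s o, Inv t.castSucc s → 0 ≤ κ t s o)
    (hF : ∀ t s o, Inv t.castSucc s → κ t s o ≠ 0 → Inv t.succ (F t s o))
    (h : ∀ t s, Inv t.castSucc s → ∑ o, κ t s o * Φ t.succ (F t s o) ≤ Φ t.castSucc s)
    (s₀ : σ) (h0 : Inv 0 s₀) :
    ∑ τ : Fin T → O, (∏ t, κ t (chain F s₀ τ t.castSucc) (τ t)) *
      Φ (Fin.last T) (chain F s₀ τ (Fin.last T)) ≤ Φ 0 s₀ := by
  induction T generalizing s₀ with
  | zero => simp [Fin.last, chain_zero]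
  | succ T ih =>
    -- Condition on the first input: the rest is a shorter chain started at `F 0 s₀ o`.
    rw [← (Fin.consEquiv fun _ => O).sum_comp, Fintype.sum_prod_type]
    refine le_trans (Finset.sum_le_sum fun o _ => ?_) (h 0 s₀ h0)
    have e : ∀ τ : Fin T → O,
        (∏ t, κ t (chain F s₀ (Fin.cons o τ : Fin (T + 1) → O) t.castSucc)
          ((Fin.cons o τ : Fin (T + 1) → O) t)) *
          Φ (Fin.last (T + 1)) (chain F s₀ (Fin.cons o τ : Fin (T + 1) → O) (Fin.last (T + 1))) =
        κ 0 s₀ o * ((∏ t : Fin T, κ t.succ (chain (fun r => F r.succ) (F 0 s₀ o) τ t.castSucc)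
          (τ t)) * Φ (Fin.last T).succ (chain (fun r => F r.succ) (F 0 s₀ o) τ (Fin.last T))) := by
      intro τ
      rw [Fin.prod_univ_succ, ← Fin.succ_last, chain_cons, mul_assoc]
      congr 1
      congr 1
      refine Finset.prod_congr rfl fun t _ => ?_
      rw [← Fin.succ_castSucc, chain_cons, Fin.cons_succ]
    refine le_trans (Finset.sum_le_sum fun τ _ => (e τ).le) ?_
    rw [← Finset.mul_sum]
    -- The invariant survives only transitions of nonzero weight; the others contribute nothing.
    by_cases hz : κ 0 s₀ o = 0
    · simp [hz]
    refine mul_le_mul_of_nonneg_left ?_ (hκ 0 s₀ o h0)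
    exact ih (fun r => F r.succ) (fun t => κ t.succ) (fun t => Φ t.succ) (fun t => Inv t.succ)
      (fun t => hκ t.succ) (fun t => hF t.succ) (fun t => h t.succ) _ (hF 0 s₀ o h0 hz)

/-! ### Runs with a prescribed transcript -/

/-- What is revealed in each round: whether there is an update, and the sampled indices. -/
abbrev Transcript (d T m : ℕ) : Type := Fin T → Option (Fin m → Fin d)

/-- The state of the learner, with the threshold replaced by the index of its noise. -/
structure TState (d T : ℕ) where
  k : ℕ
  cache : List (Example d)
  w : Fin d → ℝ
  wt : Fin d → ℝ
  ep : Fin (T + 1)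

variable {d T : ℕ}

/-- The state before the first round. -/
def TState.init (d T : ℕ) : TState d T where
  k := 0
  cache := []
  w := fun _ => 1 / (d : ℝ)
  wt := fun _ => 1 / (d : ℝ)
  ep := 0

open Classical in
/-- The cache after the example `e` has been processed. -/
def TState.newCache (s : TState d T) (e : Example d) : List (Example d) :=
  if predict s.wt e.1 ≠ e.2 then s.cache ++ [e] else s.cache

/-- The weights after an update at the end of a round with example `e`. -/
def TState.newW (P : Params) (s : TState d T) (e : Example d) : Fin d → ℝ :=
  match (s.newCache e).head? with
  | some c => mwUpdate P.η s.w c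
  | none => s.w

open Classical in
/-- The empirical distribution of a list of indices. -/
def empIdx {m : ℕ} (J : Fin m → Fin d) : Fin d → ℝ := fun j =>
  1 / (m : ℝ) * ((Finset.univ.filter fun i => J i = j).card : ℝ)

/-- The state after round `t` with revealed information `o`. -/
def TState.next (P : Params) (S : Fin T → Example d) (t : Fin T) (s : TState d T)
    (o : Option (Fin P.m → Fin d)) : TState d T :=
  match o with
  | none => { s with cache := s.newCache (S t) }
  | some J =>
    { k := s.k + 1
      cache := []
      w := s.newW P (S t)
      wt := empIdx J
      ep := t.succ }

/-- The state before round `t` in a run with transcript `τ`. -/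
abbrev trun (P : Params) (S : Fin T → Example d) (τ : Transcript d T P.m)
    (t : Fin (T + 1)) : TState d T :=
  chain (TState.next P S) (TState.init d T) τ t

/-- The outcome of the `AboveThreshold` test in round `t`. -/
def Test (P : Params) (S : Fin T → Example d) (z : (Fin (T + 1) → ℝ) × (Fin T → ℝ))
    (t : Fin T) (s : TState d T) : Prop :=
  P.L + z.1 s.ep ≤ ((s.newCache (S t)).length : ℝ) + z.2 t ∧ (s.k : ℝ) < P.K

/-- The threshold and query noise that leads to the updates of the transcript `τ`. -/
def testSet (P : Params) (S : Fin T → Example d) (τ : Transcript d T P.m) :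
    Set ((Fin (T + 1) → ℝ) × (Fin T → ℝ)) :=
  {z | ∀ t, (τ t).isSome ↔ Test P S z t (trun P S τ t.castSucc)}

/-- The uniform numbers that lead to the samples of the transcript `τ`. -/
def sampleSet (P : Params) (S : Fin T → Example d) (τ : Transcript d T P.m) :
    Set (Fin T → Fin P.m → ℝ) :=
  {u | ∀ t J, τ t = some J → ∀ i, Selects ((trun P S τ t.castSucc).newW P (S t)) (u t i) (J i)}

/-- The noise that leads to the transcript `τ`. -/
def noiseSet (P : Params) (S : Fin T → Example d) (τ : Transcript d T P.m) :
    Set (Noise T P.m) :=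
  {ω | (ω.thr, ω.query) ∈ testSet P S τ ∧ ω.unif ∈ sampleSet P S τ}

/-- The probability of the samples `o` drawn from `w`. -/
def sampleProb {m : ℕ} (w : Fin d → ℝ) (o : Option (Fin m → Fin d)) : ℝ :=
  match o with
  | none => 1
  | some J => ∏ i, w (J i)

/-- The probability of all samples of the transcript. -/
def pathProb (P : Params) (S : Fin T → Example d) (τ : Transcript d T P.m) : ℝ :=
  ∏ t, sampleProb ((trun P S τ t.castSucc).newW P (S t)) (τ t)

/-! ### Weights are probability vectors -/

/-- A probability vector with positive entries. -/
def IsProbVec (w : Fin d → ℝ) : Prop := (∀ j, 0 < w j) ∧ ∑ j, w j = 1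

theorem IsProbVec.le_one {w : Fin d → ℝ} (hw : IsProbVec w) (j : Fin d) : w j ≤ 1 := by
  rw [← hw.2]
  exact Finset.single_le_sum (fun i _ => (hw.1 i).le) (Finset.mem_univ j)

theorem IsProbVec.sum_mul_exp_pos {w : Fin d → ℝ} (hw : IsProbVec w) (f : Fin d → ℝ) :
    0 < ∑ j, w j * Real.exp (f j) := by
  refine Finset.sum_pos (fun j _ => mul_pos (hw.1 j) (Real.exp_pos _)) ?_
  by_contra h
  have := hw.2
  rw [Finset.not_nonempty_iff_eq_empty.1 h] at this
  simp at this

theorem IsProbVec.mwUpdate {w : Fin d → ℝ} (hw : IsProbVec w) (η : ℝ) (e : Example d) :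
    IsProbVec (mwUpdate η w e) := by
  have hZ := hw.sum_mul_exp_pos fun k => η * ((e.2 : ℤ) : ℝ) * ((e.1 k : ℤ) : ℝ)
  refine ⟨fun j => mul_pos (div_pos (Real.exp_pos _) hZ) (hw.1 j), ?_⟩
  simp only [DPWinnow.mwUpdate, div_mul_eq_mul_div]
  rw [← Finset.sum_div, div_eq_one_iff_eq hZ.ne']
  exact Finset.sum_congr rfl fun j _ => mul_comm _ _

theorem isProbVec_init (hd : 0 < d) : IsProbVec (TState.init d T).w := by
  have : (0 : ℝ) < d := by exact_mod_cast hd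
  refine ⟨fun j => by simpa [TState.init] using this, ?_⟩
  simp [TState.init, this.ne']

theorem IsProbVec.newW {P : Params} {s : TState d T} (hs : IsProbVec s.w) (e : Example d) :
    IsProbVec (s.newW P e) := by
  unfold TState.newW
  split
  · exact hs.mwUpdate _ _
  · exact hs

theorem IsProbVec.next {P : Params} {S : Fin T → Example d} {t : Fin T} {s : TState d T}
    (hs : IsProbVec s.w) (o : Option (Fin P.m → Fin d)) : IsProbVec (s.next P S t o).w := by
  cases o with
  | none => exact hs
  | some J => exact hs.newW _

theorem isProbVec_trun (hd : 0 < d) (P : Params) (S : Fin T → Example d)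
    (τ : Transcript d T P.m) (t : Fin (T + 1)) : IsProbVec (trun P S τ t).w :=
  chain_inv (fun _ (s : TState d T) => IsProbVec s.w) (isProbVec_init hd)
    (fun _ _ _ h => h.next _) t

theorem sampleProb_pos {m : ℕ} {w : Fin d → ℝ} (hw : IsProbVec w) (o : Option (Fin m → Fin d)) :
    0 < sampleProb w o := by
  cases o with
  | none => exact one_pos
  | some J => exact Finset.prod_pos fun i _ => hw.1 _

theorem pathProb_pos (hd : 0 < d) (P : Params) (S : Fin T → Example d)
    (τ : Transcript d T P.m) : 0 < pathProb P S τ :=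
  Finset.prod_pos fun _ _ => sampleProb_pos ((isProbVec_trun hd P S τ _).newW _) _

theorem sum_sampleProb_some {m : ℕ} {w : Fin d → ℝ} (hw : IsProbVec w) :
    ∑ J : Fin m → Fin d, sampleProb w (some J) = 1 := by
  simp only [sampleProb]
  rw [← Fintype.sum_pow, hw.2, one_pow]

/-! ### The transcript determines the run -/

theorem selects_unique {w : Fin d → ℝ} (hw : ∀ j, 0 ≤ w j) {u : ℝ} {j j' : Fin d}
    (h : Selects w u j) (h' : Selects w u j') : j = j' := by
  have key : ∀ a b : Fin d, Selects w u a → Selects w u b → ¬ a < b := by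
    intro a b ha hb hab
    have : ∑ k ∈ Finset.univ.filter (· ≤ a), w k ≤ ∑ k ∈ Finset.univ.filter (· < b), w k := by
      refine Finset.sum_le_sum_of_subset_of_nonneg ?_ fun i _ _ => hw i
      intro i hi
      simp only [Finset.mem_filter, Finset.mem_univ, true_and] at hi ⊢
      exact lt_of_le_of_lt hi hab
    linarith [ha.2, hb.1]
  exact le_antisymm (not_lt.1 (key j' j h' h)) (not_lt.1 (key j j' h h'))

theorem empirical_eq_empIdx {m : ℕ} {w : Fin d → ℝ} (hw : ∀ j, 0 ≤ w j) {u : Fin m → ℝ}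
    {J : Fin m → Fin d} (h : ∀ i, Selects w (u i) (J i)) : empirical w u = empIdx J := by
  funext j
  unfold empirical empIdx
  congr 3
  ext i
  simp only [Finset.mem_filter, Finset.mem_univ, true_and]
  exact ⟨fun hi => selects_unique hw (h i) hi, fun hi => hi ▸ h i⟩

/-- The state of the learner that corresponds to a state of the run with given transcript. -/
def TState.toLState (L : ℝ) (thr : Fin (T + 1) → ℝ) (s : TState d T) : LState d where
  k := s.k
  cache := s.cache
  w := s.w
  wt := s.wt
  thr := L + thr s.ep

/-- On `noiseSet` all tests and samples come out as `τ` prescribes, so the noise enters the state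
only through the current threshold. Hence hypotheses and error counts are functions of `τ`. -/
theorem stateAt_eq_trun (hd : 0 < d) {P : Params} {S : Fin T → Example d}
    {τ : Transcript d T P.m} {ω : Noise T P.m} (h : ω ∈ noiseSet P S τ) (t : Fin (T + 1)) :
    stateAt P S ω t = (trun P S τ t).toLState P.L ω.thr := by
  induction t using Fin.induction with
  | zero => rfl
  | succ t ih =>
    have e : stateAt P S ω t.succ = step P ω (S t) t (stateAt P S ω t.castSucc) := rfl
    rw [e, ih, show trun P S τ t.succ = TState.next P S t (trun P S τ t.castSucc) (τ t) from rfl]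
    have h1 := h.1 t
    have h2 := h.2 t
    have hw := (isProbVec_trun hd P S τ t.castSucc).newW (P := P) (S t)
    change _ ↔ Test P S _ t (trun P S τ t.castSucc) at h1
    generalize trun P S τ t.castSucc = s at *
    generalize τ t = o at *
    unfold Test at h1
    cases o with
    | none =>
      have h1' : ¬ (P.L + ω.thr s.ep ≤ ((s.newCache (S t)).length : ℝ) + ω.query t ∧
        (s.k : ℝ) < P.K) := by simpa using h1
      exact if_neg h1'
    | some J =>
      have h1' : (P.L + ω.thr s.ep ≤ ((s.newCache (S t)).length : ℝ) + ω.query t ∧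
        (s.k : ℝ) < P.K) := by simpa using h1
      refine (if_pos h1').trans ?_
      have := empirical_eq_empIdx (fun j => (hw.1 j).le) (h2 J rfl)
      simp only [TState.toLState, TState.next, ← this]
      rfl

/-- Makes the events of different transcripts disjoint, so that their probabilities add up. -/
theorem noiseSet_injective (hd : 0 < d) {P : Params} {S : Fin T → Example d}
    {τ τ' : Transcript d T P.m} {ω : Noise T P.m} (h : ω ∈ noiseSet P S τ)
    (h' : ω ∈ noiseSet P S τ') : τ = τ' := by
  have key : ∀ t : Fin T, trun P S τ t.castSucc = trun P S τ' t.castSucc → τ t = τ' t := by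
    intro t e
    have h1 := h.1 t
    have h1' := h'.1 t
    have h2 := h.2 t
    have h2' := h'.2 t
    have hw := (isProbVec_trun hd P S τ' t.castSucc).newW (P := P) (S t)
    simp only [trun] at *
    rw [e] at h1 h2
    cases ho : τ t with
    | none =>
      cases ho' : τ' t with
      | none => rfl
      | some J' => simp [ho, ho'] at h1 h1'; exact absurd h1' h1
    | some J =>
      cases ho' : τ' t with
      | none => simp [ho, ho'] at h1 h1'; exact absurd h1 h1'
      | some J' =>
        congr 1
        funext i
        exact selects_unique (fun j => (hw.1 j).le) (h2 J ho i) (h2' J' ho' i)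
  have all : ∀ t, trun P S τ t = trun P S τ' t := by
    intro t
    induction t using Fin.induction with
    | zero => rfl
    | succ t ih =>
      rw [trun, trun, chain_succ, chain_succ, key t ih]
      exact congrArg (fun s => TState.next P S t s (τ' t)) ih
  funext t
  exact key t (all _)

/-! ### The law of the transcript -/

open Classical in
/-- The weight of the transition `o` in round `t`, given the threshold and query noise. -/
def transWeight (P : Params) (S : Fin T → Example d) (z : (Fin (T + 1) → ℝ) × (Fin T → ℝ))
    (t : Fin T) (s : TState d T) (o : Option (Fin P.m → Fin d)) : ℝ :=
  if o.isSome ↔ Test P S z t s then sampleProb (s.newW P (S t)) o else 0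

/-- For frozen Laplace noise `z` the run is a Markov chain driven by the samples alone, which is the
setting of `sum_chain_le`. -/
theorem prod_transWeight (P : Params) (S : Fin T → Example d)
    (z : (Fin (T + 1) → ℝ) × (Fin T → ℝ)) (τ : Transcript d T P.m) :
    ∏ t, transWeight P S z t (trun P S τ t.castSucc) (τ t) =
      (testSet P S τ).indicator (fun _ => pathProb P S τ) z := by
  classical
  by_cases hz : z ∈ testSet P S τ
  · rw [Set.indicator_of_mem hz]
    exact Finset.prod_congr rfl fun t _ => if_pos (hz t)
  · rw [Set.indicator_of_notMem hz]
    have : ∃ t, ¬ ((τ t).isSome ↔ Test P S z t (trun P S τ t.castSucc)) := by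
      by_contra hc
      push Not at hc
      exact hz hc
    obtain ⟨t, ht⟩ := this
    exact Finset.prod_eq_zero (Finset.mem_univ t) (if_neg ht)

theorem transWeight_nonneg {P : Params} {S : Fin T → Example d}
    {z : (Fin (T + 1) → ℝ) × (Fin T → ℝ)} {t : Fin T} {s : TState d T} (hs : IsProbVec s.w)
    (o : Option (Fin P.m → Fin d)) : 0 ≤ transWeight P S z t s o := by
  unfold transWeight
  split_ifs
  · exact (sampleProb_pos (hs.newW _) o).le
  · exact le_rfl

theorem sum_transWeight_mul (P : Params) (S : Fin T → Example d)
    (z : (Fin (T + 1) → ℝ) × (Fin T → ℝ)) (t : Fin T) (s : TState d T)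
    (f : Option (Fin P.m → Fin d) → ℝ) :
    (Test P S z t s → ∑ o, transWeight P S z t s o * f o =
      ∑ J, sampleProb (s.newW P (S t)) (some J) * f (some J)) ∧
    (¬ Test P S z t s → ∑ o, transWeight P S z t s o * f o = f none) := by
  rw [Fintype.sum_option]
  constructor
  · intro h; simp [transWeight, h]
  · intro h; simp [transWeight, h, sampleProb]

theorem sum_transWeight (P : Params) (S : Fin T → Example d)
    (z : (Fin (T + 1) → ℝ) × (Fin T → ℝ)) (t : Fin T) {s : TState d T} (hs : IsProbVec s.w) :
    ∑ o, transWeight P S z t s o = 1 := by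
  have h := sum_transWeight_mul P S z t s fun _ => 1
  simp only [mul_one] at h
  by_cases ht : Test P S z t s
  · rw [h.1 ht, sum_sampleProb_some (hs.newW _)]
  · rw [h.2 ht]

theorem sum_indicator_pathProb (hd : 0 < d) (P : Params) (S : Fin T → Example d)
    (z : (Fin (T + 1) → ℝ) × (Fin T → ℝ)) :
    ∑ τ, (testSet P S τ).indicator (fun _ => pathProb P S τ) z = 1 := by
  simp_rw [← prod_transWeight]
  -- The chain inequality is one-sided; the constant potentials `1` and `-1` together give equality.
  have key : ∀ c : ℝ, (∑ τ : Transcript d T P.m,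
      ∏ t, transWeight P S z t (trun P S τ t.castSucc) (τ t)) * c ≤ c := by
    intro c
    rw [Finset.sum_mul]
    exact sum_chain_le (TState.next P S) (transWeight P S z) (fun _ _ => c)
      (fun _ s => IsProbVec s.w) (fun t s o hs => transWeight_nonneg hs o)
      (fun t s o hs _ => hs.next o)
      (fun t s hs => by rw [← Finset.sum_mul, sum_transWeight P S z t hs, one_mul])
      _ (isProbVec_init hd)
  have h1 := key 1
  have h2 := key (-1)
  linarith

/-- The law of the threshold and query noise. -/
abbrev testLaw (T : ℕ) (εhat : ℝ) : Measure ((Fin (T + 1) → ℝ) × (Fin T → ℝ)) :=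
  (Measure.pi fun _ : Fin (T + 1) => laplace (2 / εhat)).prod
    (Measure.pi fun _ : Fin T => laplace (4 / εhat))

theorem measurableSet_testSet (P : Params) (S : Fin T → Example d) (τ : Transcript d T P.m) :
    MeasurableSet (testSet P S τ) := by
  have : testSet P S τ = ⋂ t, {z | (τ t).isSome ↔ Test P S z t (trun P S τ t.castSucc)} := by
    ext z; simp [testSet]
  rw [this]
  refine MeasurableSet.iInter fun t => ?_
  refine (MeasurableSet.const _).iff (MeasurableSet.inter ?_ (MeasurableSet.const _))
  exact measurableSet_le
    (f := fun z : (Fin (T + 1) → ℝ) × (Fin T → ℝ) => P.L + z.1 (trun P S τ t.castSucc).ep)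
    (g := fun z => (((trun P S τ t.castSucc).newCache (S t)).length : ℝ) + z.2 t)
    (by fun_prop) (by fun_prop)

theorem setOf_selects (w : Fin d → ℝ) (j : Fin d) : {u | Selects w u j} =
    Set.Ico (∑ k ∈ Finset.univ.filter (· < j), w k) (∑ k ∈ Finset.univ.filter (· ≤ j), w k) := rfl

theorem measure_selects {w : Fin d → ℝ} (hw : IsProbVec w) (j : Fin d) :
    (volume : Measure ℝ).restrict (Set.Icc 0 1) {u | Selects w u j} = ENNReal.ofReal (w j) := by
  have hle : ∑ k ∈ Finset.univ.filter (· ≤ j), w k =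
      w j + ∑ k ∈ Finset.univ.filter (· < j), w k := by
    rw [← Finset.sum_insert (by simp)]
    congr 1
    ext k
    simp [le_iff_eq_or_lt]
  rw [setOf_selects, Measure.restrict_apply measurableSet_Ico, Set.inter_eq_left.2, Real.volume_Ico,
    hle]
  · congr 1; ring
  · intro x hx
    refine ⟨le_trans (Finset.sum_nonneg fun k _ => (hw.1 k).le) hx.1, hx.2.le.trans ?_⟩
    rw [← hw.2]
    exact Finset.sum_le_sum_of_subset_of_nonneg (Finset.filter_subset _ _)
      fun k _ _ => (hw.1 k).le

instance isProbabilityMeasure_unitInterval :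
    IsProbabilityMeasure ((volume : Measure ℝ).restrict (Set.Icc 0 1)) :=
  ⟨by simp⟩

/-- Once `τ` is fixed, the weights in each round do not depend on `u`, so the set is a box and its
measure factors. -/
theorem sampleSet_eq_pi (P : Params) (S : Fin T → Example d) (τ : Transcript d T P.m) :
    sampleSet P S τ = Set.pi Set.univ fun t => match τ t with
      | none => Set.univ
      | some J => Set.pi Set.univ fun i =>
          {u | Selects ((trun P S τ t.castSucc).newW P (S t)) u (J i)} := by
  ext u
  simp only [sampleSet, Set.mem_ofPred_eq, Set.mem_pi, Set.mem_univ, true_implies]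
  refine forall_congr' fun t => ?_
  cases τ t <;> simp

theorem measurableSet_sampleSet (P : Params) (S : Fin T → Example d) (τ : Transcript d T P.m) :
    MeasurableSet (sampleSet P S τ) := by
  rw [sampleSet_eq_pi]
  refine MeasurableSet.univ_pi fun t => ?_
  cases τ t with
  | none => exact MeasurableSet.univ
  | some J => exact MeasurableSet.univ_pi fun i => by rw [setOf_selects]; exact measurableSet_Ico

theorem measure_sampleSet (hd : 0 < d) (P : Params) (S : Fin T → Example d)
    (τ : Transcript d T P.m) :
    (Measure.pi fun _ : Fin T => Measure.pi fun _ : Fin P.m =>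
      (volume : Measure ℝ).restrict (Set.Icc 0 1)) (sampleSet P S τ) =
      ENNReal.ofReal (pathProb P S τ) := by
  rw [sampleSet_eq_pi, Measure.pi_pi, pathProb, ENNReal.ofReal_prod_of_nonneg fun t _ =>
    (sampleProb_pos ((isProbVec_trun hd P S τ _).newW _) _).le]
  refine Finset.prod_congr rfl fun t _ => ?_
  have hw := (isProbVec_trun hd P S τ t.castSucc).newW (P := P) (S t)
  cases τ t with
  | none => simp [sampleProb]
  | some J =>
    simp only [sampleProb]
    rw [Measure.pi_pi, ENNReal.ofReal_prod_of_nonneg fun i _ => (hw.1 _).le]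
    exact Finset.prod_congr rfl fun i _ => measure_selects hw _

theorem noiseLaw_prodAssoc {m : ℕ} {εhat : ℝ} (hε : 0 < εhat)
    (A : Set ((Fin (T + 1) → ℝ) × (Fin T → ℝ))) (B : Set (Fin T → Fin m → ℝ)) :
    noiseLaw T m εhat {ω | (ω.thr, ω.query) ∈ A ∧ ω.unif ∈ B} = testLaw T εhat A *
      (Measure.pi fun _ : Fin T => Measure.pi fun _ : Fin m =>
        (volume : Measure ℝ).restrict (Set.Icc 0 1)) B := by
  have := isProbabilityMeasure_laplace (b := 2 / εhat) (by positivity)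
  have := isProbabilityMeasure_laplace (b := 4 / εhat) (by positivity)
  rw [← Measure.prod_prod, noiseLaw, ← Measure.prodAssoc_prod,
    MeasurableEquiv.map_apply]
  rfl

theorem isProbabilityMeasure_testLaw {εhat : ℝ} (hε : 0 < εhat) :
    IsProbabilityMeasure (testLaw T εhat) := by
  have := isProbabilityMeasure_laplace (b := 2 / εhat) (by positivity)
  have := isProbabilityMeasure_laplace (b := 4 / εhat) (by positivity)
  infer_instance

theorem isProbabilityMeasure_noiseLaw {m : ℕ} {εhat : ℝ} (hε : 0 < εhat) :
    IsProbabilityMeasure (noiseLaw T m εhat) := by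
  have := isProbabilityMeasure_laplace (b := 2 / εhat) (by positivity)
  have := isProbabilityMeasure_laplace (b := 4 / εhat) (by positivity)
  unfold noiseLaw
  infer_instance

theorem measurableSet_noiseSet_inter (P : Params) (S : Fin T → Example d)
    (τ : Transcript d T P.m) {G : Set ((Fin (T + 1) → ℝ) × (Fin T → ℝ))}
    (hG : MeasurableSet G) : MeasurableSet
      {ω : Noise T P.m | (ω.thr, ω.query) ∈ testSet P S τ ∩ G ∧ ω.unif ∈ sampleSet P S τ} := by
  refine MeasurableSet.inter ?_ ?_
  · exact ((measurableSet_testSet P S τ).inter hG).preimage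
      (f := fun ω : Noise T P.m => (ω.thr, ω.query))
      (measurable_fst.prodMk (measurable_fst.comp measurable_snd))
  · exact (measurableSet_sampleSet P S τ).preimage (f := fun ω : Noise T P.m => ω.unif)
      (measurable_snd.comp measurable_snd)

theorem measurableSet_noiseSet (P : Params) (S : Fin T → Example d)
    (τ : Transcript d T P.m) : MeasurableSet (noiseSet P S τ) := by
  simpa [noiseSet] using measurableSet_noiseSet_inter P S τ MeasurableSet.univ

/-- A lower bound for an event that contains all runs with transcripts in `E` and
noise in `G`. -/
theorem sum_le_noiseLaw_real (hd : 0 < d) {P : Params} (hε : 0 < P.εhat)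
    (S : Fin T → Example d) {G : Set ((Fin (T + 1) → ℝ) × (Fin T → ℝ))} (hG : MeasurableSet G)
    (E : Finset (Transcript d T P.m)) {X : Set (Noise T P.m)}
    (hX : ∀ τ ∈ E, ∀ ω ∈ noiseSet P S τ, (ω.thr, ω.query) ∈ G → ω ∈ X) :
    ∑ τ ∈ E, (testLaw T P.εhat).real (testSet P S τ ∩ G) * pathProb P S τ ≤
      (noiseLaw T P.m P.εhat).real X := by
  have := isProbabilityMeasure_noiseLaw (T := T) (m := P.m) hε
  let B : Transcript d T P.m → Set (Noise T P.m) := fun τ =>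
    {ω | (ω.thr, ω.query) ∈ testSet P S τ ∩ G ∧ ω.unif ∈ sampleSet P S τ}
  have hB : ∀ τ, MeasurableSet (B τ) := fun τ => measurableSet_noiseSet_inter P S τ hG
  have hBn : ∀ τ, B τ ⊆ noiseSet P S τ := fun τ ω h => ⟨h.1.1, h.2⟩
  have e : ∀ τ, (testLaw T P.εhat).real (testSet P S τ ∩ G) * pathProb P S τ =
      (noiseLaw T P.m P.εhat).real (B τ) := by
    intro τ
    rw [measureReal_def, measureReal_def, noiseLaw_prodAssoc hε, measure_sampleSet hd, ENNReal.toReal_mul, ENNReal.toReal_ofReal (pathProb_pos hd P S τ).le]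
  simp_rw [e]
  rw [← measureReal_biUnion_finset]
  · refine measureReal_mono ?_
    intro ω hω
    simp only [Set.mem_iUnion] at hω
    obtain ⟨τ, hτ, h⟩ := hω
    exact hX τ hτ ω (hBn τ h) h.1.2
  · intro τ _ τ' _ hne
    rw [Function.onFun, Set.disjoint_left]
    exact fun ω h h' => hne (noiseSet_injective hd (hBn τ h) (hBn τ' h'))
  · exact fun τ _ => hB τ

theorem sum_testLaw_inter_mul (hd : 0 < d) {P : Params} (hε : 0 < P.εhat)
    (S : Fin T → Example d) {G : Set ((Fin (T + 1) → ℝ) × (Fin T → ℝ))} (hG : MeasurableSet G) :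
    ∑ τ, (testLaw T P.εhat).real (testSet P S τ ∩ G) * pathProb P S τ =
      (testLaw T P.εhat).real G := by
  have := isProbabilityMeasure_testLaw (T := T) hε
  refine le_antisymm ?_ ?_
  · have := sum_measureReal_inter_mul_le (testLaw T P.εhat) (measurableSet_testSet P S) hG
      (pathProb P S) 1 fun z _ => (sum_indicator_pathProb hd P S z).le
    linarith
  -- The lower bound is the same averaging lemma with all coefficients negated.
  · have := sum_measureReal_inter_mul_le (testLaw T P.εhat) (measurableSet_testSet P S) hG
      (fun τ => -pathProb P S τ) (-1) fun z _ => by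
        have := sum_indicator_pathProb hd P S z
        simp only [Set.indicator_neg, Finset.sum_neg_distrib]
        linarith
    simp only [mul_neg, Finset.sum_neg_distrib] at this
    linarith

/-- An upper bound for an event that contains only runs with transcripts in `E`. -/
theorem noiseLaw_real_le_sum (hd : 0 < d) {P : Params} (hε : 0 < P.εhat)
    (S : Fin T → Example d) [DecidableEq (Transcript d T P.m)]
    (E : Finset (Transcript d T P.m)) {X : Set (Noise T P.m)}
    (hX : ∀ τ ∉ E, ∀ ω ∈ noiseSet P S τ, ω ∉ X) :
    (noiseLaw T P.m P.εhat).real X ≤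
      ∑ τ ∈ E, (testLaw T P.εhat).real (testSet P S τ) * pathProb P S τ := by
  have := isProbabilityMeasure_noiseLaw (T := T) (m := P.m) hε
  -- `X` need not be measurable and the sets `noiseSet` need not cover the space, so the bound
  -- passes to the complement: the transcripts outside `E` carry all mass not carried by `E`, and
  -- `X` avoids them.
  have h1 := sum_le_noiseLaw_real hd hε S MeasurableSet.univ Eᶜ
    (X := ⋃ τ ∈ Eᶜ, noiseSet P S τ) fun τ hτ ω hω _ => Set.mem_biUnion hτ hω
  have h2 := sum_testLaw_inter_mul hd hε S MeasurableSet.univ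
  have := isProbabilityMeasure_testLaw (T := T) hε
  simp only [Set.inter_univ, probReal_univ] at h1 h2
  rw [← Finset.sum_add_sum_compl E] at h2
  have h3 : MeasurableSet (⋃ τ ∈ Eᶜ, noiseSet P S τ) :=
    Finset.measurableSet_biUnion _ fun τ _ => measurableSet_noiseSet P S τ
  have h4 : X ⊆ (⋃ τ ∈ Eᶜ, noiseSet P S τ)ᶜ := by
    intro ω hω hω'
    simp only [Set.mem_iUnion] at hω'
    obtain ⟨τ, hτ, h⟩ := hω'
    exact hX τ (Finset.mem_compl.1 hτ) ω h hω
  have h5 := measureReal_mono (μ := noiseLaw T P.m P.εhat) h4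
  rw [probReal_compl_eq_one_sub h3] at h5
  linarith

/-! ### Exponentially tilted weights -/

/-- `w` arises from `w'` by multiplicative weights with bounded exponents. -/
def Tilt (η : ℝ) (w w' : Fin d → ℝ) : Prop :=
  ∃ (h : Fin d → ℝ) (c : ℝ), (∀ j, |h j| ≤ 2) ∧ 0 < c ∧
    ∀ j, w j = c * (w' j * Real.exp (η * h j))

/-- The moments of the likelihood ratio of tilted weights. -/
theorem Tilt.sum_mul_rpow_le {η : ℝ} {w w' : Fin d → ℝ} (h : Tilt η w w') (hw : IsProbVec w)
    (hw' : IsProbVec w') {l : ℝ} (hl : 0 ≤ l) :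
    ∑ j, w j * (w j / w' j) ^ l ≤ Real.exp (2 * η ^ 2 * l * (l + 1)) := by
  obtain ⟨h, c, hh, hc, e⟩ := h
  have hr : ∀ j, w j / w' j = c * Real.exp (η * h j) := fun j => by
    rw [e j]
    field_simp [(hw'.1 j).ne']
  -- Because `w'` sums to one, the normalizing constant is itself a `w`-average.
  have hc' : c = ∑ j, w j * Real.exp (-η * h j) := by
    have : ∀ j, w j * Real.exp (-η * h j) = c * w' j := fun j => by
      rw [e j, mul_assoc, mul_assoc, ← Real.exp_add]
      simp
    simp_rw [this]
    rw [← Finset.mul_sum, hw'.2, mul_one]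
  have h1 := sum_mul_exp_le (fun j => (hw.1 j).le) hw.2 hh (-η)
  have h2 := sum_mul_exp_le (fun j => (hw.1 j).le) hw.2 hh (l * η)
  rw [← hc'] at h1
  have h3 : ∀ j, w j * (w j / w' j) ^ l = c ^ l * (w j * Real.exp (l * η * h j)) := fun j => by
    rw [hr j, Real.mul_rpow hc.le (Real.exp_pos _).le, ← Real.exp_mul]
    ring_nf
  simp_rw [h3]
  rw [← Finset.mul_sum]
  have h4 : c ^ l ≤ Real.exp (l * (-η * ∑ j, w j * h j + 2 ^ 2 * (-η) ^ 2 / 2)) := by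
    rw [mul_comm l, Real.exp_mul]
    exact Real.rpow_le_rpow hc.le h1 hl
  -- The mean of `h` cancels between the two Hoeffding bounds, leaving `2η²l + 2η²l²`.
  refine (mul_le_mul h4 h2 (hw.sum_mul_exp_pos _).le (Real.exp_pos _).le).trans ?_
  rw [← Real.exp_add]
  exact Real.exp_le_exp.2 (le_of_eq (by ring))

/-- The update with the first element of a cache. -/
def headUpdate (η : ℝ) (o : Option (Example d)) (w : Fin d → ℝ) : Fin d → ℝ :=
  match o with
  | some c => mwUpdate η w c
  | none => w

theorem newW_eq_headUpdate (P : Params) (s : TState d T) (e : Example d) :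
    s.newW P e = headUpdate P.η (s.newCache e).head? s.w := rfl

theorem abs_units_cast (a : ℤˣ) : |((a : ℤ) : ℝ)| = 1 := by
  rcases Int.units_eq_one_or a with rfl | rfl <;> simp

theorem headUpdate_eq {w : Fin d → ℝ} (hw : IsProbVec w) (η : ℝ) (o : Option (Example d)) :
    ∃ (g : Fin d → ℝ) (c : ℝ), (∀ j, |g j| ≤ 1) ∧ 0 < c ∧ ∀ j, headUpdate η o w j =
      c * (w j * Real.exp (η * g j)) := by
  cases o with
  | none => exact ⟨0, 1, fun _ => by simp, one_pos, fun j => by simp [headUpdate]⟩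
  | some e =>
    refine ⟨fun j => ((e.2 : ℤ) : ℝ) * ((e.1 j : ℤ) : ℝ), _, fun j => ?_, inv_pos.2
      (hw.sum_mul_exp_pos fun k => η * ((e.2 : ℤ) : ℝ) * ((e.1 k : ℤ) : ℝ)), fun j => ?_⟩
    · rw [abs_mul, abs_units_cast, abs_units_cast, one_mul]
    · simp only [headUpdate, mwUpdate]
      rw [← mul_assoc η]
      ring

/-- The source of the bound 2 in `Tilt`: two exponents of size at most 1 are subtracted. -/
theorem tilt_headUpdate_same {w : Fin d → ℝ} (hw : IsProbVec w) (η : ℝ)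
    (o o' : Option (Example d)) : Tilt η (headUpdate η o w) (headUpdate η o' w) := by
  obtain ⟨g, c, hg, hc, e⟩ := headUpdate_eq hw η o
  obtain ⟨g', c', hg', hc', e'⟩ := headUpdate_eq hw η o'
  refine ⟨fun j => g j - g' j, c / c', fun j => ?_, div_pos hc hc', fun j => ?_⟩
  · have := abs_sub (g j) (g' j)
    linarith [hg j, hg' j]
  · rw [e, e', mul_sub, Real.exp_sub]
    field_simp

/-- A common update multiplies both vectors by the same factors and changes only the normalization.
The exponent `h` stays the same, so tilts do not accumulate over later updates. -/
theorem Tilt.headUpdate {η : ℝ} {w w' : Fin d → ℝ} (h : Tilt η w w') (hw : IsProbVec w)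
    (hw' : IsProbVec w') (o : Option (Example d)) :
    Tilt η (headUpdate η o w) (headUpdate η o w') := by
  cases o with
  | none => exact h
  | some x =>
    obtain ⟨h, c, hh, hc, e⟩ := h
    have hZ := hw.sum_mul_exp_pos fun k => η * ((x.2 : ℤ) : ℝ) * ((x.1 k : ℤ) : ℝ)
    have hZ' := hw'.sum_mul_exp_pos fun k => η * ((x.2 : ℤ) : ℝ) * ((x.1 k : ℤ) : ℝ)
    refine ⟨h, _, hh, mul_pos (mul_pos hc (inv_pos.2 hZ)) hZ', fun j => ?_⟩
    simp only [DPWinnow.headUpdate, DPWinnow.mwUpdate]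
    have e' := e j
    set Z := ∑ k, w k * Real.exp (η * ((x.2 : ℤ) : ℝ) * ((x.1 k : ℤ) : ℝ))
    set Z' := ∑ k, w' k * Real.exp (η * ((x.2 : ℤ) : ℝ) * ((x.1 k : ℤ) : ℝ))
    rw [e']
    field_simp

/-! ### Runs on neighboring sequences -/

theorem length_newCache_le (s : TState d T) (e : Example d) :
    (s.newCache e).length ≤ s.cache.length + 1 := by
  unfold TState.newCache
  split_ifs <;> simp

theorem length_le_newCache (s : TState d T) (e : Example d) :
    s.cache.length ≤ (s.newCache e).length := by
  unfold TState.newCache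
  split_ifs <;> simp

/-- The relation between two runs with the same transcript, on sequences that differ
only in round `i`. -/
structure PairInv (P : Params) (i : Fin T) (t : Fin (T + 1)) (p : TState d T × TState d T) :
    Prop where
  k_eq : p.1.k = p.2.k
  wt_eq : p.1.wt = p.2.wt
  ep_eq : p.1.ep = p.2.ep
  ep_le : p.1.ep ≤ t
  probVec : IsProbVec p.1.w
  probVec' : IsProbVec p.2.w
  -- The three phases: before round `i` is processed; from then to the end of its epoch; after that
  -- epoch. An update in round `r` opens epoch `r + 1`, so `i.castSucc < ep` says that an update has
  -- occurred in round `i` or later.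
  phase : (t ≤ i.castSucc ∧ p.1 = p.2) ∨
    (i.castSucc < t ∧ p.1.ep ≤ i.castSucc ∧ p.1.w = p.2.w ∧
      p.1.cache.length ≤ p.2.cache.length + 1 ∧ p.2.cache.length ≤ p.1.cache.length + 1) ∨
    (i.castSucc < t ∧ i.castSucc < p.1.ep ∧ p.1.cache = p.2.cache ∧ Tilt P.η p.1.w p.2.w)

variable {P : Params} {S S' : Fin T → Example d} {i : Fin T}

theorem newCache_congr {s s' : TState d T} (hw : s.wt = s'.wt) (hc : s.cache = s'.cache)
    (e : Example d) : s.newCache e = s'.newCache e := by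
  unfold TState.newCache
  rw [hw, hc]

/-- Until the epoch of round `i` ends, the old weights agree and at most the update example differs;
later the example agrees and the tilt is inherited. -/
theorem PairInv.tilt_newW (hS : ∀ j, j ≠ i → S j = S' j) {t : Fin T}
    {p : TState d T × TState d T} (h : PairInv P i t.castSucc p) :
    Tilt P.η (p.1.newW P (S t)) (p.2.newW P (S' t)) := by
  rw [newW_eq_headUpdate, newW_eq_headUpdate]
  rcases h.phase with ⟨_, e⟩ | ⟨_, _, e, _⟩ | ⟨hi, _, hc, ht⟩
  · rw [e]; exact tilt_headUpdate_same h.probVec' _ _ _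
  · rw [e]; exact tilt_headUpdate_same h.probVec' _ _ _
  · have : S t = S' t := hS t fun h => by subst h; exact lt_irrefl _ hi
    rw [this, newCache_congr h.wt_eq hc]
    exact ht.headUpdate h.probVec h.probVec' _

theorem PairInv.length_newCache (hS : ∀ j, j ≠ i → S j = S' j) {t : Fin T}
    {p : TState d T × TState d T} (h : PairInv P i t.castSucc p) :
    (p.1.newCache (S t)).length ≤ (p.2.newCache (S' t)).length + 1 ∧
    (p.2.newCache (S' t)).length ≤ (p.1.newCache (S t)).length + 1 := by
  rcases h.phase with ⟨_, e⟩ | ⟨hi, _, _, h1, h2⟩ | ⟨hi, _, hc, _⟩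
  · rw [e]
    have h1 := length_newCache_le p.2 (S t)
    have h2 := length_newCache_le p.2 (S' t)
    have h3 := length_le_newCache p.2 (S t)
    have h4 := length_le_newCache p.2 (S' t)
    omega
  · have : S t = S' t := hS t fun h => by subst h; exact lt_irrefl _ hi
    rw [this]
    unfold TState.newCache
    rw [h.wt_eq]
    split_ifs
    · simp only [List.length_append, List.length_singleton]; omega
    · exact ⟨h1, h2⟩
  · have : S t = S' t := hS t fun h => by subst h; exact lt_irrefl _ hi
    rw [this, newCache_congr h.wt_eq hc]
    omega

theorem PairInv.newCache_eq (hS : ∀ j, j ≠ i → S j = S' j) {t : Fin T}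
    {p : TState d T × TState d T} (h : PairInv P i t.castSucc p)
    (ht : t < i ∨ i.castSucc < p.1.ep) :
    p.1.newCache (S t) = p.2.newCache (S' t) := by
  rcases h.phase with ⟨hi, e⟩ | ⟨hi, h1, _⟩ | ⟨hi, _, hc, _⟩
  · have : t < i := ht.resolve_right fun h1 => absurd (h.ep_le.trans hi) (not_le.2 h1)
    rw [hS t this.ne, e]
  · exact absurd h1 (not_le.2 (ht.resolve_left fun h1 => absurd hi
      (not_lt.2 (Fin.castSucc_le_castSucc_iff.2 h1.le))))
  · have : S t = S' t := hS t fun h => by subst h; exact lt_irrefl _ hi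
    rw [this, newCache_congr h.wt_eq hc]

theorem PairInv.next (hS : ∀ j, j ≠ i → S j = S' j) {t : Fin T}
    {p : TState d T × TState d T} (h : PairInv P i t.castSucc p)
    (o : Option (Fin P.m → Fin d)) :
    PairInv P i t.succ (p.1.next P S t o, p.2.next P S' t o) := by
  have hle : t.castSucc ≤ t.succ := Fin.castSucc_lt_succ.le
  have htilt := h.tilt_newW hS
  have hlen := h.length_newCache hS
  have hceq := h.newCache_eq hS
  refine ⟨?_, ?_, ?_, ?_, h.probVec.next o, h.probVec'.next o, ?_⟩
  · cases o <;> simp [TState.next, h.k_eq]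
  · cases o <;> simp [TState.next, h.wt_eq]
  · cases o <;> simp [TState.next, h.ep_eq]
  · cases o
    · exact h.ep_le.trans hle
    · exact le_rfl
  · by_cases hti : t < i
    · left
      refine ⟨by rw [← Fin.succ_le_castSucc_iff] at hti; exact hti, ?_⟩
      rcases h.phase with ⟨_, e⟩ | ⟨hi, _⟩ | ⟨hi, _⟩
      · simp only
        unfold TState.next TState.newW
        rw [e, hS t hti.ne]
      · exact absurd hi (not_lt.2 (Fin.castSucc_le_castSucc_iff.2 hti.le))
      · exact absurd hi (not_lt.2 (Fin.castSucc_le_castSucc_iff.2 hti.le))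
    · right
      have hit : i.castSucc < t.succ :=
        lt_of_le_of_lt (Fin.castSucc_le_castSucc_iff.2 (not_lt.1 hti)) Fin.castSucc_lt_succ
      cases o with
      | some J => exact Or.inr ⟨hit, hit, rfl, htilt⟩
      | none =>
        rcases h.phase with ⟨hi, e⟩ | ⟨_, h1, hw, _⟩ | ⟨_, h1, _, hw⟩
        · exact Or.inl ⟨hit, h.ep_le.trans hi, by simp [TState.next, e], hlen⟩
        · exact Or.inl ⟨hit, h1, hw, hlen⟩
        · exact Or.inr ⟨hit, h1, hceq (Or.inr h1), hw⟩

theorem pairInv_init (hd : 0 < d) (P : Params) (i : Fin T) :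
    PairInv P i 0 (TState.init d T, TState.init d T) :=
  ⟨rfl, rfl, rfl, le_rfl, isProbVec_init hd, isProbVec_init hd, Or.inl ⟨Fin.zero_le _, rfl⟩⟩

theorem pairInv_trun (hd : 0 < d) (hS : ∀ j, j ≠ i → S j = S' j) (τ : Transcript d T P.m)
    (t : Fin (T + 1)) : PairInv P i t (trun P S τ t, trun P S' τ t) := by
  induction t using Fin.induction with
  | zero => exact pairInv_init hd P i
  | succ t ih => exact ih.next hS (τ t)

/-! ### Epochs -/

theorem succ_le_ep {τ : Transcript d T P.m} {t : Fin T} (ht : (τ t).isSome) (t' : Fin (T + 1))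
    (h : t.succ ≤ t') : t.succ ≤ (trun P S τ t').ep := by
  induction t' using Fin.induction with
  | zero => exact absurd h (by simp)
  | succ r ih =>
    rw [trun, chain_succ]
    rcases eq_or_lt_of_le (Fin.succ_le_succ_iff.1 h) with rfl | hlt
    · obtain ⟨J, hJ⟩ := Option.isSome_iff_exists.1 ht
      rw [hJ]; exact le_rfl
    · cases hr : τ r with
      | none => exact ih (by rw [Fin.succ_le_castSucc_iff]; exact hlt)
      | some J => exact h

/-- Confines the influence of round `i` on the tests to a single threshold variable. -/
theorem ep_eq_or_lt (τ : Transcript d T P.m) (i : Fin T) (t : Fin (T + 1))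
    (h : i.castSucc ≤ t) :
    (trun P S τ t).ep = (trun P S τ i.castSucc).ep ∨ i.castSucc < (trun P S τ t).ep := by
  induction t using Fin.induction with
  | zero => left; rw [le_antisymm h (Fin.zero_le _)]
  | succ r ih =>
    rcases eq_or_lt_of_le h with e | hlt
    · left; rw [e]
    · have hle : i.castSucc ≤ r.castSucc := by
        rw [Fin.castSucc_le_castSucc_iff]
        exact Fin.castSucc_lt_succ_iff.1 hlt
      rw [trun, chain_succ]
      cases hr : τ r with
      | none => exact ih hle
      | some J => exact Or.inr hlt

/-- `AboveThreshold` is private: a change in one round changes the probability of a pattern of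
updates by a factor of at most `exp εhat`. -/
theorem testLaw_testSet_le (hd : 0 < d) (hε : 0 < P.εhat) (hS : ∀ j, j ≠ i → S j = S' j)
    (τ : Transcript d T P.m) :
    (testLaw T P.εhat).real (testSet P S τ) ≤
      Real.exp P.εhat * (testLaw T P.εhat).real (testSet P S' τ) := by
  classical
  have hp := pairInv_trun hd hS τ
  set r := (trun P S τ i.castSucc).ep with hr
  have hlap := isProbabilityMeasure_laplace (b := 2 / P.εhat) (by positivity)
  have hlap' := isProbabilityMeasure_laplace (b := 4 / P.εhat) (by positivity)
  have hlaw := isProbabilityMeasure_testLaw (T := T) hε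
  -- An epoch ends with its first positive test, so at most one query variable has to be shifted.
  have huniq : ∀ t t' : Fin T, (trun P S τ t.castSucc).ep = r → (trun P S τ t'.castSucc).ep = r →
      (τ t).isSome → (τ t').isSome → t = t' := by
    have key : ∀ t t' : Fin T, (trun P S τ t.castSucc).ep = r →
        (trun P S τ t'.castSucc).ep = r → (τ t).isSome → ¬ t < t' := by
      intro t t' h h' ht hlt
      have h1 := succ_le_ep (S := S) ht t'.castSucc (by rw [Fin.succ_le_castSucc_iff]; exact hlt)
      have h2 : (trun P S τ t.castSucc).ep ≤ t.castSucc := (hp t.castSucc).ep_le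
      rw [h'] at h1
      rw [h] at h2
      exact absurd (h1.trans h2) (not_le.2 Fin.castSucc_lt_succ)
    intro t t' h h' ht ht'
    exact le_antisymm (not_lt.1 (key t' t h' h ht')) (not_lt.1 (key t t' h h' ht))
  obtain ⟨sh, hshm, hsh, hsh1, hsh2⟩ : ∃ sh : (Fin T → ℝ) → Fin T → ℝ, Measurable sh ∧
      (∀ f : (Fin T → ℝ) → ENNReal, Measurable f →
        ∫⁻ x, f (sh x) ∂(Measure.pi fun _ : Fin T => laplace (4 / P.εhat)) ≤
        ENNReal.ofReal (Real.exp (P.εhat / 2)) *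
          ∫⁻ x, f x ∂(Measure.pi fun _ : Fin T => laplace (4 / P.εhat))) ∧
      (∀ q t, (trun P S τ t.castSucc).ep = r → (τ t).isSome → sh q t = q t + 2) ∧
      (∀ q t, ¬ ((trun P S τ t.castSucc).ep = r ∧ (τ t).isSome) → sh q t = q t) := by
    by_cases hex : ∃ t, (trun P S τ t.castSucc).ep = r ∧ (τ t).isSome
    · obtain ⟨t, ht, hts⟩ := hex
      refine ⟨fun x => Function.update x t (x t + 2), by fun_prop, fun f hf => ?_, ?_, ?_⟩
      · have h := lintegral_pi_laplace_update_le (b := 4 / P.εhat) (a := 2) (by positivity)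
          (by norm_num) t hf
        rwa [show 2 / (4 / P.εhat) = P.εhat / 2 by field_simp; norm_num] at h
      · intro q t' h h'
        rw [huniq t' t h ht h' hts]; simp
      · intro q t' h'
        exact Function.update_of_ne (fun e => h' (by rw [e]; exact ⟨ht, hts⟩)) _ _
    · refine ⟨id, measurable_id, fun f _ => ?_, fun q t h h' => absurd ⟨t, h, h'⟩ hex,
        fun _ _ _ => rfl⟩
      refine le_mul_of_one_le_left zero_le ?_
      rw [ENNReal.one_le_ofReal]
      exact Real.one_le_exp (by positivity)
  have hA' := measurableSet_testSet P S' τ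
  -- Raising the threshold by 1 keeps negative tests negative when the count grows by 1. Raising the
  -- query noise by 2 keeps the positive test positive when the count drops by 1 as well. With
  -- scales `2 / εhat` and `4 / εhat` each shift costs `exp (εhat / 2)`.
  have hsub : ∀ z : (Fin (T + 1) → ℝ) × (Fin T → ℝ), z ∈ testSet P S τ →
      (Function.update z.1 r (z.1 r + 1), sh z.2) ∈ testSet P S' τ := by
    intro z hz t
    have hz := hz t
    have hpt := hp t.castSucc
    have hlen := hpt.length_newCache hS
    have hceq := hpt.newCache_eq hS
    have hk : (trun P S τ t.castSucc).k = (trun P S' τ t.castSucc).k := hpt.k_eq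
    have hep : (trun P S τ t.castSucc).ep = (trun P S' τ t.castSucc).ep := hpt.ep_eq
    unfold Test at hz ⊢
    simp only at hlen hceq ⊢
    rw [← hk, ← hep]
    by_cases he : (trun P S τ t.castSucc).ep = r
    · have hl1 : (((trun P S τ t.castSucc).newCache (S t)).length : ℝ) ≤
        ((trun P S' τ t.castSucc).newCache (S' t)).length + 1 := by exact_mod_cast hlen.1
      have hl2 : (((trun P S' τ t.castSucc).newCache (S' t)).length : ℝ) ≤
        ((trun P S τ t.castSucc).newCache (S t)).length + 1 := by exact_mod_cast hlen.2
      rw [he] at hz ⊢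
      rw [Function.update_self]
      by_cases ho : (τ t).isSome
      · rw [hsh1 _ _ he ho]
        have := hz.1 ho
        exact ⟨fun _ => ⟨by linarith [this.1], this.2⟩, fun _ => ho⟩
      · rw [hsh2 _ _ fun h => ho h.2]
        refine ⟨fun h => absurd h ho, fun h => hz.2 ⟨by linarith [h.1], h.2⟩⟩
    · rw [Function.update_of_ne he, hsh2 _ _ fun h => he h.1, ← hceq]
      · exact hz
      · by_cases hti : t < i
        · exact Or.inl hti
        · exact Or.inr ((ep_eq_or_lt τ i t.castSucc
            (Fin.castSucc_le_castSucc_iff.2 (not_lt.1 hti))).resolve_left he)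
  have hmain : testLaw T P.εhat (testSet P S τ) ≤
      ENNReal.ofReal (Real.exp P.εhat) * testLaw T P.εhat (testSet P S' τ) := by
    let f : (Fin (T + 1) → ℝ) × (Fin T → ℝ) → ENNReal := (testSet P S' τ).indicator 1
    have hf : Measurable f := measurable_one.indicator hA'
    have hsm : Measurable fun x : Fin (T + 1) → ℝ => Function.update x r (x r + 1) := by fun_prop
    rw [← lintegral_indicator_one (measurableSet_testSet P S τ), ← lintegral_indicator_one hA']
    calc ∫⁻ z, (testSet P S τ).indicator 1 z ∂testLaw T P.εhat
        ≤ ∫⁻ z, f (Function.update z.1 r (z.1 r + 1), sh z.2) ∂testLaw T P.εhat := by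
          refine lintegral_mono fun z => ?_
          by_cases hz : z ∈ testSet P S τ
          · simp only [f]
            rw [Set.indicator_of_mem hz, Set.indicator_of_mem (hsub z hz)]
            exact le_rfl
          · rw [Set.indicator_of_notMem hz]; exact zero_le
      _ = ∫⁻ a, ∫⁻ q, f (Function.update a r (a r + 1), sh q)
            ∂(Measure.pi fun _ : Fin T => laplace (4 / P.εhat))
            ∂(Measure.pi fun _ : Fin (T + 1) => laplace (2 / P.εhat)) :=
          lintegral_prod (f := fun z : (Fin (T + 1) → ℝ) × (Fin T → ℝ) =>
            f (Function.update z.1 r (z.1 r + 1), sh z.2))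
            (hf.comp ((hsm.comp measurable_fst).prodMk (hshm.comp measurable_snd))).aemeasurable
      _ ≤ ∫⁻ a, ENNReal.ofReal (Real.exp (P.εhat / 2)) *
            ∫⁻ q, f (Function.update a r (a r + 1), q)
            ∂(Measure.pi fun _ : Fin T => laplace (4 / P.εhat))
            ∂(Measure.pi fun _ : Fin (T + 1) => laplace (2 / P.εhat)) :=
          lintegral_mono fun a => hsh (fun q => f (Function.update a r (a r + 1), q))
            (hf.comp measurable_prodMk_left)
      _ ≤ ENNReal.ofReal (Real.exp (P.εhat / 2)) * (ENNReal.ofReal (Real.exp (P.εhat / 2)) *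
            ∫⁻ a, ∫⁻ q, f (a, q)
            ∂(Measure.pi fun _ : Fin T => laplace (4 / P.εhat))
            ∂(Measure.pi fun _ : Fin (T + 1) => laplace (2 / P.εhat))) := by
          have hg : Measurable fun a => ∫⁻ q, f (a, q)
            ∂(Measure.pi fun _ : Fin T => laplace (4 / P.εhat)) := hf.lintegral_prod_right'
          refine (lintegral_const_mul _ (hg.comp hsm)).le.trans ?_
          refine mul_le_mul_right ?_ _
          have h := lintegral_pi_laplace_update_le (b := 2 / P.εhat) (a := 1) (by positivity)
            (by norm_num) r hg
          rwa [show 1 / (2 / P.εhat) = P.εhat / 2 by field_simp] at h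
      _ = ENNReal.ofReal (Real.exp P.εhat) * ∫⁻ z, f z ∂testLaw T P.εhat := by
          rw [← mul_assoc, ← ENNReal.ofReal_mul (Real.exp_pos _).le, ← Real.exp_add, add_halves,
            lintegral_prod f hf.aemeasurable]
  rw [measureReal_def, measureReal_def, ← ENNReal.toReal_ofReal (Real.exp_pos P.εhat).le,
    ← ENNReal.toReal_mul]
  exact ENNReal.toReal_mono (ENNReal.mul_ne_top ENNReal.ofReal_ne_top (measure_ne_top _ _)) hmain

/-! ### Differential privacy -/

/-- The moments of the likelihood ratio of all samples, for given threshold and query noise. -/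
theorem sum_indicator_ratio_le (hd : 0 < d) (hS : ∀ j, j ≠ i → S j = S' j) {N : ℕ}
    (hN : ∀ k : ℕ, (k : ℝ) < P.K → k + 1 ≤ N) {l : ℝ} (hl : 0 ≤ l)
    (z : (Fin (T + 1) → ℝ) × (Fin T → ℝ)) :
    ∑ τ, (testSet P S' τ).indicator
      (fun _ => pathProb P S τ * (pathProb P S τ / pathProb P S' τ) ^ l) z ≤
      Real.exp (2 * P.η ^ 2 * l * (l + 1) * P.m * N) := by
  classical
  set c : ℝ := 2 * P.η ^ 2 * l * (l + 1) with hc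
  have hc0 : 0 ≤ c := by positivity
  let F : Fin T → TState d T × TState d T → Option (Fin P.m → Fin d) →
    TState d T × TState d T := fun t p o => (p.1.next P S t o, p.2.next P S' t o)
  let g : Fin T → TState d T × TState d T → Option (Fin P.m → Fin d) → ℝ := fun t p o =>
    sampleProb (p.1.newW P (S t)) o *
      (sampleProb (p.1.newW P (S t)) o / sampleProb (p.2.newW P (S' t)) o) ^ l
  -- A hybrid: tests follow `S'`, because the test factor is exchanged first, while samples are
  -- weighted by `S` and by the power of the likelihood ratio.
  let κ : Fin T → TState d T × TState d T → Option (Fin P.m → Fin d) → ℝ := fun t p o =>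
    if o.isSome ↔ Test P S' z t p.2 then g t p o else 0
  -- An allowance of `exp (c m)` for every update still available.
  let Φ : Fin (T + 1) → TState d T × TState d T → ℝ := fun _ p =>
    Real.exp (c * P.m * (N - p.2.k))
  have hchain : ∀ (τ : Transcript d T P.m) t,
      chain F (TState.init d T, TState.init d T) τ t = (trun P S τ t, trun P S' τ t) := by
    intro τ t
    induction t using Fin.induction with
    | zero => rfl
    | succ t ih => rw [chain_succ, ih]; rfl
  have hgpos : ∀ (t : Fin T) (p : TState d T × TState d T) o, PairInv P i t.castSucc p →
      0 < g t p o := by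
    intro t p o h
    have h1 := sampleProb_pos (h.probVec.newW (P := P) (S t)) o
    have h2 := sampleProb_pos (h.probVec'.newW (P := P) (S' t)) o
    exact mul_pos h1 (Real.rpow_pos_of_pos (div_pos h1 h2) _)
  have hsum : ∀ (t : Fin T) (p : TState d T × TState d T), PairInv P i t.castSucc p →
      ∑ J, g t p (some J) ≤ Real.exp (c * P.m) := by
    intro t p h
    have hw := h.probVec.newW (P := P) (S t)
    have hw' := h.probVec'.newW (P := P) (S' t)
    have h1 := (h.tilt_newW hS).sum_mul_rpow_le hw hw' hl
    have h2 : ∀ J, g t p (some J) = ∏ r, ((p.1.newW P (S t)) (J r) *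
        ((p.1.newW P (S t)) (J r) / (p.2.newW P (S' t)) (J r)) ^ l) := by
      intro J
      simp only [g, sampleProb]
      rw [Finset.prod_mul_distrib, Real.finsetProd_rpow _ _ fun r _ =>
        (div_pos (hw.1 _) (hw'.1 _)).le, Finset.prod_div_distrib]
    simp_rw [h2]
    rw [← Fintype.sum_pow fun j => (p.1.newW P (S t)) j *
        ((p.1.newW P (S t)) j / (p.2.newW P (S' t)) j) ^ l, mul_comm c, Real.exp_nat_mul]
    refine pow_le_pow_left₀ (Finset.sum_nonneg fun j _ => ?_) h1 _
    exact mul_nonneg (hw.1 j).le (Real.rpow_nonneg (div_pos (hw.1 _) (hw'.1 _)).le _)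
  have key := sum_chain_le F κ Φ (fun t p => PairInv P i t p ∧ p.2.k ≤ N)
    (fun t p o h => by
      simp only [κ]
      split_ifs
      · exact (hgpos t p o h.1).le
      · exact le_rfl)
    (fun t p o h hne => by
      refine ⟨h.1.next hS o, ?_⟩
      have ho : o.isSome ↔ Test P S' z t p.2 := by
        by_contra hc; exact hne (if_neg hc)
      cases o with
      | none => exact h.2
      | some J => exact hN _ (ho.1 rfl).2)
    (fun t p h => by
      rw [Fintype.sum_option]
      by_cases ht : Test P S' z t p.2
      · have e : ∀ J, κ t p (some J) * Φ t.succ (F t p (some J)) =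
            g t p (some J) * Real.exp (c * P.m * (N - (p.2.k + 1))) := by
          intro J
          simp only [κ, Option.isSome_some, ht, if_true, Φ, F, TState.next]
          push_cast
          rfl
        simp_rw [e]
        rw [← Finset.sum_mul]
        simp only [κ, Option.isSome_none, ht, Bool.false_eq_true, iff_true, if_false, zero_mul,
          zero_add]
        refine (mul_le_mul_of_nonneg_right (hsum t p h.1) (Real.exp_pos _).le).trans ?_
        rw [← Real.exp_add]
        exact Real.exp_le_exp.2 (le_of_eq (by ring))
      · simp [κ, ht, g, sampleProb, Φ, F, TState.next])
    (TState.init d T, TState.init d T) ⟨pairInv_init hd P i, Nat.zero_le _⟩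
  refine le_trans (Finset.sum_le_sum fun τ _ => ?_) (key.trans (le_of_eq ?_))
  · have hp := pairInv_trun hd hS τ (P := P)
    by_cases hz : z ∈ testSet P S' τ
    · rw [Set.indicator_of_mem hz]
      have h1 : ∏ t, κ t (chain F (TState.init d T, TState.init d T) τ t.castSucc) (τ t) =
          pathProb P S τ * (pathProb P S τ / pathProb P S' τ) ^ l := by
        have : ∀ t, κ t (chain F (TState.init d T, TState.init d T) τ t.castSucc) (τ t) =
            g t (trun P S τ t.castSucc, trun P S' τ t.castSucc) (τ t) := fun t => by
          rw [hchain]; exact if_pos (hz t)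
        simp_rw [this, g]
        rw [Finset.prod_mul_distrib, Real.finsetProd_rpow _ _ fun t _ => (div_pos
          (sampleProb_pos ((hp t.castSucc).probVec.newW _) _)
          (sampleProb_pos ((hp t.castSucc).probVec'.newW _) _)).le, Finset.prod_div_distrib]
        rfl
      rw [h1]
      refine le_mul_of_one_le_right ?_ ?_
      · have h1 := pathProb_pos hd P S τ
        have h2 := pathProb_pos hd P S' τ
        exact mul_nonneg h1.le (Real.rpow_nonneg (div_pos h1 h2).le _)
      · rw [hchain]
        refine Real.one_le_exp (mul_nonneg (by positivity) (sub_nonneg.2 ?_))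
        have hk : ∀ t, (trun P S' τ t).k ≤ N := by
          intro t
          induction t using Fin.induction with
          | zero => exact Nat.zero_le _
          | succ t ih =>
            have ht := hz t
            rw [trun, chain_succ]
            cases ho : τ t with
            | none => exact ih
            | some J =>
              rw [ho] at ht
              exact hN _ (ht.1 rfl).2
        exact_mod_cast hk _
    · rw [Set.indicator_of_notMem hz]
      refine mul_nonneg (Finset.prod_nonneg fun t _ => ?_) (Real.exp_pos _).le
      rw [hchain]
      simp only [κ]
      split_ifs
      · exact (hgpos t _ _ (hp _)).le
      · exact le_rfl
  · simp [Φ, TState.init]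

/-- Differential privacy from a moment bound for the samples. -/
theorem isDP_hypotheses (hd : 0 < d) (hε : 0 < P.εhat) {N : ℕ}
    (hN : ∀ k : ℕ, (k : ℝ) < P.K → k + 1 ≤ N) {l ε ε₁ δ : ℝ} (hl : 0 ≤ l)
    (hε₁ : P.εhat + ε₁ ≤ ε)
    (hδ : Real.exp (P.εhat - l * ε₁ + 2 * P.η ^ 2 * l * (l + 1) * P.m * N) ≤ δ) :
    IsDP (noiseLaw T P.m P.εhat) ε δ
      (fun (S : Fin T → Example d) ω => hypotheses P S ω) := by
  classical
  rintro S S' ⟨i, hS⟩ R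
  have hlaw := isProbabilityMeasure_testLaw (T := T) hε
  set ζ := testLaw T P.εhat with hζ
  let E : Finset (Transcript d T P.m) :=
    Finset.univ.filter fun τ => (fun t : Fin T => (trun P S τ t.castSucc).wt) ∈ R
  have hup := noiseLaw_real_le_sum hd hε S E (X := {ω | hypotheses P S ω ∈ R}) (by
    intro τ hτ ω hω hR
    refine hτ (Finset.mem_filter.2 ⟨Finset.mem_univ _, ?_⟩)
    change hypotheses P S ω ∈ R at hR
    convert hR using 1
    funext t
    simp only [hypotheses]
    rw [stateAt_eq_trun hd hω]
    rfl)
  have hlow := sum_le_noiseLaw_real hd hε S' MeasurableSet.univ E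
    (X := {ω | hypotheses P S' ω ∈ R}) (by
      intro τ hτ ω hω _
      have hR := (Finset.mem_filter.1 hτ).2
      change hypotheses P S' ω ∈ R
      convert hR using 1
      funext t
      simp only [hypotheses]
      rw [stateAt_eq_trun hd hω]
      exact (pairInv_trun hd hS τ t.castSucc).wt_eq.symm)
  simp only [Set.inter_univ] at hlow
  have hmom := sum_measureReal_inter_mul_le ζ (measurableSet_testSet P S') MeasurableSet.univ _ _
    fun z _ => sum_indicator_ratio_le hd hS hN hl z
  simp only [Set.inter_univ, probReal_univ, mul_one] at hmom
  set M := Real.exp (2 * P.η ^ 2 * l * (l + 1) * P.m * N) with hM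
  -- Either the likelihood ratio is at most `exp ε₁`, or the `l`-th power of ratio times `exp (-ε₁)`
  -- is at least 1.
  have hpt : ∀ τ, pathProb P S τ ≤ Real.exp ε₁ * pathProb P S' τ + Real.exp (-(l * ε₁)) *
      (pathProb P S τ * (pathProb P S τ / pathProb P S' τ) ^ l) := by
    intro τ
    have h1 := pathProb_pos hd P S τ
    have h2 := pathProb_pos hd P S' τ
    rcases le_or_gt (pathProb P S τ) (Real.exp ε₁ * pathProb P S' τ) with h | h
    · exact h.trans (le_add_of_nonneg_right (mul_nonneg (Real.exp_pos _).le
        (mul_nonneg h1.le (Real.rpow_nonneg (div_pos h1 h2).le _))))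
    · refine le_trans ?_ (le_add_of_nonneg_left (mul_pos (Real.exp_pos _) h2).le)
      rw [mul_left_comm]
      refine le_mul_of_one_le_right h1.le ?_
      have h3 : Real.exp ε₁ ≤ pathProb P S τ / pathProb P S' τ := by
        rw [le_div_iff₀ h2]; exact h.le
      have h4 := Real.rpow_le_rpow (Real.exp_pos _).le h3 hl
      rw [← Real.exp_mul] at h4
      calc (1 : ℝ) = Real.exp (-(l * ε₁)) * Real.exp (ε₁ * l) := by
            rw [← Real.exp_add]; ring_nf; simp
        _ ≤ _ := mul_le_mul_of_nonneg_left h4 (Real.exp_pos _).le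
  have hζ0 : ∀ τ, 0 ≤ ζ.real (testSet P S' τ) := fun τ => measureReal_nonneg
  calc (noiseLaw T P.m P.εhat).real {ω | hypotheses P S ω ∈ R}
      ≤ ∑ τ ∈ E, ζ.real (testSet P S τ) * pathProb P S τ := hup
    _ ≤ ∑ τ ∈ E, Real.exp P.εhat * (Real.exp ε₁ *
          (ζ.real (testSet P S' τ) * pathProb P S' τ) + Real.exp (-(l * ε₁)) *
          (ζ.real (testSet P S' τ) *
            (pathProb P S τ * (pathProb P S τ / pathProb P S' τ) ^ l))) := by
        refine Finset.sum_le_sum fun τ _ => ?_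
        have h1 := mul_le_mul_of_nonneg_right (testLaw_testSet_le hd hε hS τ)
          (pathProb_pos hd P S τ).le
        have h2 := mul_le_mul_of_nonneg_left (hpt τ)
          (mul_nonneg (Real.exp_pos P.εhat).le (hζ0 τ))
        refine (h1.trans h2).trans (le_of_eq (by ring))
    _ = Real.exp P.εhat * (Real.exp ε₁ *
          ∑ τ ∈ E, ζ.real (testSet P S' τ) * pathProb P S' τ) +
          Real.exp P.εhat * (Real.exp (-(l * ε₁)) * ∑ τ ∈ E, ζ.real (testSet P S' τ) *
            (pathProb P S τ * (pathProb P S τ / pathProb P S' τ) ^ l)) := by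
        rw [← Finset.mul_sum, Finset.sum_add_distrib, ← Finset.mul_sum, ← Finset.mul_sum, mul_add]
    _ ≤ Real.exp P.εhat * (Real.exp ε₁ *
          (noiseLaw T P.m P.εhat).real {ω | hypotheses P S' ω ∈ R}) +
          Real.exp P.εhat * (Real.exp (-(l * ε₁)) * M) := by
        have h3 : ∑ τ ∈ E, ζ.real (testSet P S' τ) *
            (pathProb P S τ * (pathProb P S τ / pathProb P S' τ) ^ l) ≤ M := by
          refine le_trans (Finset.sum_le_univ_sum_of_nonneg fun τ => ?_) hmom
          have h1 := pathProb_pos hd P S τ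
          have h2 := pathProb_pos hd P S' τ
          exact mul_nonneg (hζ0 τ) (mul_nonneg h1.le (Real.rpow_nonneg (div_pos h1 h2).le _))
        gcongr
    _ ≤ _ := by
        refine add_le_add ?_ (le_trans (le_of_eq ?_) hδ)
        · rw [← mul_assoc, ← Real.exp_add]
          exact mul_le_mul_of_nonneg_right (Real.exp_le_exp.2 hε₁) measureReal_nonneg
        · rw [hM, ← Real.exp_add, ← Real.exp_add]
          congr 1
          ring

/-! ### Margins -/

/-- The margin of the weights `w` on the example `e`. -/
def margin (w : Fin d → ℝ) (e : Example d) : ℝ := ((e.2 : ℤ) : ℝ) * dot w e.1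

theorem margin_eq_sum (w : Fin d → ℝ) (e : Example d) :
    margin w e = ∑ j, w j * (((e.2 : ℤ) : ℝ) * ((e.1 j : ℤ) : ℝ)) := by
  unfold margin dot
  rw [Finset.mul_sum]
  exact Finset.sum_congr rfl fun j _ => by ring

theorem margin_nonpos_of_predict_ne {w : Fin d → ℝ} {e : Example d}
    (h : predict w e.1 ≠ e.2) : margin w e ≤ 0 := by
  unfold predict at h
  unfold margin
  rcases Int.units_eq_one_or e.2 with he | he <;> rw [he] at h ⊢ <;> split_ifs at h with h0
  · exact absurd rfl h
  · simp; linarith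
  · simpa using h0
  · exact absurd rfl h

theorem abs_label_mul (e : Example d) (j : Fin d) :
    |((e.2 : ℤ) : ℝ) * ((e.1 j : ℤ) : ℝ)| ≤ 1 := by
  rw [abs_mul, abs_units_cast, abs_units_cast, one_mul]

theorem margin_empIdx {m : ℕ} (hm : 0 < m) (J : Fin m → Fin d) (e : Example d) :
    m * margin (empIdx J) e = ∑ i, ((e.2 : ℤ) : ℝ) * ((e.1 (J i) : ℤ) : ℝ) := by
  classical
  have hm' : (m : ℝ) ≠ 0 := by positivity
  have h : ∀ j, (m : ℝ) * (empIdx J j * (((e.2 : ℤ) : ℝ) * ((e.1 j : ℤ) : ℝ))) =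
      ∑ i, if J i = j then ((e.2 : ℤ) : ℝ) * ((e.1 j : ℤ) : ℝ) else 0 := by
    intro j
    rw [← Finset.sum_filter, Finset.sum_const, nsmul_eq_mul, empIdx]
    field_simp
  rw [margin_eq_sum, Finset.mul_sum]
  simp_rw [h]
  rw [Finset.sum_comm]
  simp

open Classical in
/-- Sampled weights rarely err on examples on which the original weights have a margin. -/
theorem sum_sampleProb_error_le {m : ℕ} (hm : 0 < m) {w : Fin d → ℝ} (hw : IsProbVec w) {ρ : ℝ}
    (hρ : 0 ≤ ρ) (e : Example d) :
    ∑ J : Fin m → Fin d, sampleProb w (some J) * (if predict (empIdx J) e.1 ≠ e.2 then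
      Real.exp (m * ρ / 2 * (margin w e - ρ / 2)) else 0) ≤ Real.exp (-(m * ρ ^ 2 / 8)) := by
  have h1 := sum_mul_exp_le (fun j => (hw.1 j).le) hw.2 (abs_label_mul e) (-(ρ / 2))
  rw [← margin_eq_sum] at h1
  have h2 := pow_le_pow_left₀ (hw.sum_mul_exp_pos _).le h1 m
  rw [Fintype.sum_pow, ← Real.exp_nat_mul] at h2
  have h3 : ∀ J : Fin m → Fin d, sampleProb w (some J) * (if predict (empIdx J) e.1 ≠ e.2 then
      Real.exp (m * ρ / 2 * (margin w e - ρ / 2)) else 0) ≤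
      Real.exp (m * ρ / 2 * (margin w e - ρ / 2)) *
        ∏ i, (w (J i) * Real.exp (-(ρ / 2) * (((e.2 : ℤ) : ℝ) * ((e.1 (J i) : ℤ) : ℝ)))) := by
    intro J
    rw [Finset.prod_mul_distrib, ← Real.exp_sum, ← Finset.mul_sum, ← margin_empIdx hm]
    have h4 := (sampleProb_pos hw (some J)).le
    split_ifs with h
    · have h5 := margin_nonpos_of_predict_ne h
      rw [mul_comm (sampleProb _ _)]
      -- On an error the sampled margins sum to at most 0, so `exp (-(ρ/2) · sum)` dominates the
      -- indicator.
      refine mul_le_mul_of_nonneg_left (le_mul_of_one_le_right h4 (Real.one_le_exp ?_))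
        (Real.exp_pos _).le
      have : 0 ≤ ρ / 2 * (m * -margin (empIdx J) e) := by
        have : 0 ≤ -margin (empIdx J) e := by linarith
        positivity
      linarith
    · rw [mul_zero]
      exact mul_nonneg (Real.exp_pos _).le (mul_nonneg h4 (Real.exp_pos _).le)
  refine (Finset.sum_le_sum fun J _ => h3 J).trans ?_
  rw [← Finset.mul_sum]
  refine (mul_le_mul_of_nonneg_left h2 (Real.exp_pos _).le).trans ?_
  rw [← Real.exp_add]
  exact Real.exp_le_exp.2 (le_of_eq (by ring))

/-! ### The potential -/

/-- The negative cross entropy of `w` relative to `v`. -/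
def crossLog (v w : Fin d → ℝ) : ℝ := ∑ j, v j * Real.log (w j)

theorem crossLog_nonpos {v w : Fin d → ℝ} (hv : ∀ j, 0 ≤ v j) (hw : IsProbVec w) :
    crossLog v w ≤ 0 :=
  Finset.sum_nonpos fun j _ => mul_nonpos_of_nonneg_of_nonpos (hv j)
    (Real.log_nonpos (hw.1 j).le (hw.le_one j))

theorem crossLog_init {v : Fin d → ℝ} (hv : ∑ j, v j = 1) :
    crossLog v (TState.init d T).w = -Real.log d := by
  simp [crossLog, TState.init, ← Finset.sum_mul, hv]

/-- The change is `η * margin v e` minus the log of the normalizer, which Hoeffding's lemma bounds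
by `η * margin w e + η² / 2`. -/
theorem le_crossLog_mwUpdate {v w : Fin d → ℝ} (hv1 : ∑ j, v j = 1)
    (hw : IsProbVec w) (η : ℝ) (e : Example d) :
    crossLog v w + η * margin v e - η * margin w e - η ^ 2 / 2 ≤
      crossLog v (mwUpdate η w e) := by
  have hZ := hw.sum_mul_exp_pos fun k => η * ((e.2 : ℤ) : ℝ) * ((e.1 k : ℤ) : ℝ)
  have h1 := sum_mul_exp_le (fun j => (hw.1 j).le) hw.2 (abs_label_mul e) η
  rw [← margin_eq_sum] at h1
  simp_rw [← mul_assoc η] at h1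
  have h2 := Real.log_le_log hZ h1
  rw [Real.log_exp] at h2
  have h3 : crossLog v (mwUpdate η w e) = crossLog v w + η * margin v e -
      Real.log (∑ k, w k * Real.exp (η * ((e.2 : ℤ) : ℝ) * ((e.1 k : ℤ) : ℝ))) := by
    have : ∀ j, v j * Real.log (mwUpdate η w e j) = v j * Real.log (w j) +
        η * (v j * (((e.2 : ℤ) : ℝ) * ((e.1 j : ℤ) : ℝ))) - v j *
        Real.log (∑ k, w k * Real.exp (η * ((e.2 : ℤ) : ℝ) * ((e.1 k : ℤ) : ℝ))) := by
      intro j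
      unfold mwUpdate
      rw [Real.log_mul (div_pos (Real.exp_pos _) hZ).ne' (hw.1 j).ne',
        Real.log_div (Real.exp_pos _).ne' hZ.ne', Real.log_exp]
      ring
    unfold crossLog
    simp_rw [this]
    rw [Finset.sum_sub_distrib, Finset.sum_add_distrib, ← Finset.mul_sum, ← margin_eq_sum,
      ← Finset.sum_mul, hv1, one_mul]
  rw [h3]
  linarith

/-- The excess of the number of updates over the progress of multiplicative weights. -/
def excess (P : Params) (ρ : ℝ) (v : Fin d → ℝ) (k : ℕ) (w : Fin d → ℝ) : ℝ :=
  Real.exp (P.m * ρ / (2 * P.η) *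
    (k * ((P.η * ρ - P.η ^ 2) / 2) - Real.log d - crossLog v w))

/-- The contribution to the excess of an update with the example `e`. -/
def errTerm (P : Params) (ρ : ℝ) (w : Fin d → ℝ) (e : Example d) : ℝ :=
  Real.exp (P.m * ρ / 2 * (margin w e - ρ / 2))

/-- The rate `mρ / (2η)` in `excess` is chosen so that the shortfall of progress appears as
`errTerm`, whose average over sampling errors is controlled by `sum_sampleProb_error_le`. -/
theorem excess_mwUpdate_le {ρ : ℝ} {v w : Fin d → ℝ} (hη : 0 < P.η) (hρ : 0 ≤ ρ)
    (hv1 : ∑ j, v j = 1) (hw : IsProbVec w) {e : Example d} (he : ρ ≤ margin v e) (k : ℕ) :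
    excess P ρ v (k + 1) (mwUpdate P.η w e) ≤ excess P ρ v k w * errTerm P ρ w e := by
  unfold excess errTerm
  rw [← Real.exp_add]
  refine Real.exp_le_exp.2 ?_
  have h := le_crossLog_mwUpdate hv1 hw P.η e
  have h2 := mul_le_mul_of_nonneg_left he hη.le
  have e1 : P.m * ρ / 2 * (margin w e - ρ / 2) =
      P.m * ρ / (2 * P.η) * (P.η * (margin w e - ρ / 2)) := by
    field_simp
  rw [e1, ← mul_add]
  refine mul_le_mul_of_nonneg_left ?_ (by positivity)
  push_cast
  linarith

open Classical in
/-- The potential of a state before round `t`. -/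
def potential (P : Params) (S : Fin T → Example d) (ρ : ℝ) (v : Fin d → ℝ) (t : Fin (T + 1))
    (s : TState d T) : ℝ :=
  -- With a nonempty cache the example of the next update, hence its factor, is already known. With
  -- an empty cache a union bound runs over all remaining examples on which the current hypothesis
  -- errs; this uses that the sequence is fixed in advance.
  if P.K ≤ s.k then excess P ρ v s.k s.w else
    excess P ρ v s.k s.w * match s.cache.head? with
      | some e => errTerm P ρ s.w e
      | none => ∑ r : Fin T, if t ≤ r.castSucc ∧ predict s.wt (S r).1 ≠ (S r).2 then
          errTerm P ρ s.w (S r) else 0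

theorem potential_nonneg {ρ : ℝ} {v : Fin d → ℝ} (t : Fin (T + 1)) (s : TState d T) :
    0 ≤ potential P S ρ v t s := by
  unfold potential
  have h : 0 ≤ excess P ρ v s.k s.w := (Real.exp_pos _).le
  have h2 : ∀ w (e : Example d), 0 ≤ errTerm P ρ w e := fun w e => (Real.exp_pos _).le
  split_ifs
  · exact h
  · refine mul_nonneg h ?_
    split
    · exact h2 _ _
    · refine Finset.sum_nonneg fun r _ => ?_
      split_ifs
      · exact h2 _ _
      · exact le_rfl

theorem excess_mul_errTerm_le_potential {ρ : ℝ} {v : Fin d → ℝ} {t : Fin T} {s : TState d T}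
    (hk : (s.k : ℝ) < P.K) {e : Example d} (he : (s.newCache (S t)).head? = some e) :
    excess P ρ v s.k s.w * errTerm P ρ s.w e ≤ potential P S ρ v t.castSucc s := by
  have h : 0 ≤ excess P ρ v s.k s.w := (Real.exp_pos _).le
  unfold potential
  rw [if_neg (not_le.2 hk)]
  refine mul_le_mul_of_nonneg_left ?_ h
  unfold TState.newCache at he
  cases hc : s.cache with
  | cons a l =>
    rw [hc] at he
    have : a = e := by split_ifs at he <;> simpa using he
    rw [this]
    exact le_rfl
  | nil =>
    rw [hc] at he
    split_ifs at he with hp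
    · have : S t = e := by simpa using he
      subst this
      refine le_trans (le_of_eq ?_) (Finset.single_le_sum (f := fun r : Fin T =>
        if t.castSucc ≤ r.castSucc ∧ predict s.wt (S r).1 ≠ (S r).2 then
          errTerm P ρ s.w (S r) else 0) (fun r _ => ?_) (Finset.mem_univ t))
      · exact (if_pos ⟨le_rfl, hp⟩).symm
      · split_ifs
        · exact (Real.exp_pos _).le
        · exact le_rfl
    · simp at he

/-- Without an update the weights stay. The first error replaces the sum by one of its terms, and a
correct prediction only shortens its range. -/
theorem potential_next_none_le {ρ : ℝ} {v : Fin d → ℝ} (t : Fin T) (s : TState d T) :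
    potential P S ρ v t.succ (s.next P S t none) ≤ potential P S ρ v t.castSucc s := by
  by_cases hk : (s.k : ℝ) < P.K
  · cases hc : (s.newCache (S t)).head? with
    | some e =>
      refine le_trans (le_of_eq ?_) (excess_mul_errTerm_le_potential hk hc)
      unfold potential
      rw [if_neg (not_le.2 (by exact hk))]
      simp only [TState.next, hc]
    | none =>
      have hn : s.newCache (S t) = [] := List.head?_eq_none_iff.1 hc
      have hcache : s.cache = [] := by
        have := length_le_newCache s (S t)
        rw [hn] at this
        exact List.length_eq_zero_iff.1 (Nat.le_zero.1 this)
      unfold potential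
      rw [if_neg (not_le.2 hk), if_neg (not_le.2 (by exact hk))]
      simp only [TState.next, hc, hcache, List.head?_nil]
      refine mul_le_mul_of_nonneg_left (Finset.sum_le_sum fun r _ => ?_) (Real.exp_pos _).le
      have h0 : 0 ≤ errTerm P ρ s.w (S r) := (Real.exp_pos _).le
      by_cases h1 : t.succ ≤ r.castSucc ∧ predict s.wt (S r).1 ≠ (S r).2
      · exact (if_pos h1).le.trans (if_pos ⟨Fin.castSucc_lt_succ.le.trans h1.1, h1.2⟩).ge
      · refine (if_neg h1).le.trans ?_
        split_ifs
        · exact h0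
        · exact le_rfl
  · unfold potential
    rw [if_pos (not_lt.1 hk), if_pos (by exact not_lt.1 hk)]
    exact le_rfl

/-- The update pays the known factor `errTerm`, and fresh samples open a new sum whose average is at
most `T exp (-mρ²/8) ≤ 1`. -/
theorem sum_potential_next_some_le {ρ : ℝ} {v : Fin d → ℝ} (hη : 0 < P.η) (hρ : 0 ≤ ρ)
    (hm : 0 < P.m) (hb : T * Real.exp (-(P.m * ρ ^ 2 / 8)) ≤ 1)
    (hv1 : ∑ j, v j = 1) {t : Fin T} {s : TState d T} (hs : IsProbVec s.w)
    (hk : (s.k : ℝ) < P.K) (hne : s.newCache (S t) ≠ [])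
    (hv : ∀ e ∈ s.newCache (S t), ρ ≤ margin v e) :
    ∑ J, sampleProb (s.newW P (S t)) (some J) *
      potential P S ρ v t.succ (s.next P S t (some J)) ≤ potential P S ρ v t.castSucc s := by
  classical
  obtain ⟨e, l, hel⟩ := List.exists_cons_of_ne_nil hne
  have he : (s.newCache (S t)).head? = some e := by rw [hel]; rfl
  have hw := hs.newW (P := P) (S t)
  have hnw : s.newW P (S t) = mwUpdate P.η s.w e := by
    rw [newW_eq_headUpdate, he]; rfl
  refine le_trans ?_ (excess_mul_errTerm_le_potential hk he)
  refine le_trans ?_ (excess_mwUpdate_le hη hρ hv1 hs (hv e (by rw [hel]; simp)) s.k)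
  rw [← hnw]
  set w' := s.newW P (S t) with hw'
  have h0 : 0 ≤ excess P ρ v (s.k + 1) w' := (Real.exp_pos _).le
  by_cases hk' : P.K ≤ ((s.k + 1 : ℕ) : ℝ)
  · have : ∀ J, potential P S ρ v t.succ (s.next P S t (some J)) = excess P ρ v (s.k + 1) w' :=
      fun J => if_pos hk'
    simp_rw [this]
    rw [← Finset.sum_mul, sum_sampleProb_some hw, one_mul]
  · have : ∀ J, potential P S ρ v t.succ (s.next P S t (some J)) = excess P ρ v (s.k + 1) w' *
        ∑ r : Fin T, if t.succ ≤ r.castSucc ∧ predict (empIdx J) (S r).1 ≠ (S r).2 then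
          errTerm P ρ w' (S r) else 0 := fun J => if_neg hk'
    simp_rw [this]
    have hle : ∀ J : Fin P.m → Fin d, sampleProb w' (some J) * (excess P ρ v (s.k + 1) w' *
        ∑ r : Fin T, if t.succ ≤ r.castSucc ∧ predict (empIdx J) (S r).1 ≠ (S r).2 then
          errTerm P ρ w' (S r) else 0) ≤ excess P ρ v (s.k + 1) w' *
        ∑ r : Fin T, sampleProb w' (some J) * if predict (empIdx J) (S r).1 ≠ (S r).2 then
          errTerm P ρ w' (S r) else 0 := by
      intro J
      rw [mul_left_comm, ← Finset.mul_sum]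
      refine mul_le_mul_of_nonneg_left (mul_le_mul_of_nonneg_left
        (Finset.sum_le_sum fun r _ => ?_) (sampleProb_pos hw _).le) h0
      have : 0 ≤ errTerm P ρ w' (S r) := (Real.exp_pos _).le
      by_cases h1 : predict (empIdx J) (S r).1 ≠ (S r).2
      · rw [if_pos h1]
        split_ifs
        · exact le_rfl
        · exact this
      · rw [if_neg h1, if_neg fun h => h1 h.2]
    refine (Finset.sum_le_sum fun J _ => hle J).trans ?_
    rw [← Finset.mul_sum, Finset.sum_comm]
    refine mul_le_of_le_one_right h0 (le_trans (Finset.sum_le_sum fun r _ =>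
      sum_sampleProb_error_le hm hw hρ (S r)) ?_)
    simpa using hb

theorem potential_init_le {ρ : ℝ} {v : Fin d → ℝ} (hK : 0 < P.K) (hρ : 0 ≤ ρ)
    (hv1 : ∑ j, v j = 1) :
    potential P S ρ v 0 (TState.init d T) ≤ T * Real.exp (-(P.m * ρ ^ 2 / 8)) := by
  unfold potential
  have hk : ((TState.init d T).k : ℝ) = 0 := by simp [TState.init]
  rw [if_neg (by rw [hk]; exact not_le.2 hK)]
  have h1 : excess P ρ v (TState.init d T).k (TState.init d T).w = 1 := by
    rw [excess, crossLog_init hv1, hk]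
    simp
  rw [h1, one_mul]
  have h2 : (T : ℝ) * Real.exp (-(P.m * ρ ^ 2 / 8)) =
      ∑ r : Fin T, Real.exp (-(P.m * ρ ^ 2 / 8)) := by simp
  rw [h2]
  refine Finset.sum_le_sum fun r _ => ?_
  split_ifs with h
  · refine Real.exp_le_exp.2 ?_
    have h3 : margin (TState.init d T).w (S r) ≤ 0 := margin_nonpos_of_predict_ne h.2
    have : P.m * ρ / 2 * margin (TState.init d T).w (S r) ≤ 0 :=
      mul_nonpos_of_nonneg_of_nonpos (by positivity) h3
    nlinarith [mul_nonneg (Nat.cast_nonneg (α := ℝ) P.m) (sq_nonneg ρ)]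
  · exact (Real.exp_pos _).le

/-- `K` updates at the nominal rate would exceed the total range `log d` of `crossLog`, so the
exponent of `excess` is nonnegative. -/
theorem one_le_potential {ρ : ℝ} {v : Fin d → ℝ} (hη : 0 < P.η) (hρ : 0 ≤ ρ)
    (hgap : 0 < P.η * ρ - P.η ^ 2) (hK : P.K = 2 * Real.log d / (P.η * ρ - P.η ^ 2))
    (hv : ∀ j, 0 ≤ v j) (t : Fin (T + 1)) {s : TState d T} (hs : IsProbVec s.w)
    (hk : P.K ≤ s.k) : 1 ≤ potential P S ρ v t s := by
  unfold potential
  rw [if_pos hk]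
  refine Real.one_le_exp (mul_nonneg (by positivity) ?_)
  have h1 := crossLog_nonpos hv hs
  rw [hK, div_le_iff₀ hgap] at hk
  linarith

/-! ### The error bound -/

theorem mem_newCache {s : TState d T} {e x : Example d} (h : x ∈ s.newCache e) :
    x ∈ s.cache ∨ x = e := by
  unfold TState.newCache at h
  split_ifs at h
  · simpa using h
  · exact Or.inl h

open Classical in
/-- For fixed threshold and query noise, if updates never happen with an empty cache, the budget
of updates is rarely exhausted. -/
theorem sum_indicator_exhausted_le (hd : 0 < d) {ρ : ℝ} {v : Fin d → ℝ} (hη : 0 < P.η)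
    (hρ : 0 ≤ ρ) (hm : 0 < P.m) (hb : T * Real.exp (-(P.m * ρ ^ 2 / 8)) ≤ 1) (hKpos : 0 < P.K)
    (hgap : 0 < P.η * ρ - P.η ^ 2) (hK : P.K = 2 * Real.log d / (P.η * ρ - P.η ^ 2))
    (hv : ∀ j, 0 ≤ v j) (hv1 : ∑ j, v j = 1) (hS : ∀ t, ρ ≤ margin v (S t))
    {z : (Fin (T + 1) → ℝ) × (Fin T → ℝ)}
    (hz : ∀ t s, Test P S z t s → s.newCache (S t) ≠ []) :
    ∑ τ, (testSet P S τ).indicator (fun _ =>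
      if P.K ≤ (trun P S τ (Fin.last T)).k then pathProb P S τ else 0) z ≤
      T * Real.exp (-(P.m * ρ ^ 2 / 8)) := by
  have key := sum_chain_le (TState.next P S) (transWeight P S z) (potential P S ρ v)
    (fun _ s => IsProbVec s.w ∧ ∀ e ∈ s.cache, ρ ≤ margin v e)
    (fun t s o hs => transWeight_nonneg hs.1 o)
    (fun t s o hs _ => by
      refine ⟨hs.1.next o, fun e he => ?_⟩
      cases o with
      | some J => simp [TState.next] at he
      | none =>
        rcases mem_newCache he with h | rfl
        · exact hs.2 e h
        · exact hS t)
    (fun t s hs => by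
      by_cases ht : Test P S z t s
      · rw [(sum_transWeight_mul P S z t s _).1 ht]
        refine sum_potential_next_some_le hη hρ hm hb hv1 hs.1 ht.2 (hz t s ht) fun e he => ?_
        rcases mem_newCache he with h | rfl
        · exact hs.2 e h
        · exact hS t
      · rw [(sum_transWeight_mul P S z t s _).2 ht]
        exact potential_next_none_le t s)
    (TState.init d T) ⟨isProbVec_init hd, fun e he => by simp [TState.init] at he⟩
  refine le_trans (Finset.sum_le_sum fun τ _ => ?_)
    (key.trans (potential_init_le hKpos hρ hv1))
  rw [prod_transWeight]
  by_cases hzt : z ∈ testSet P S τ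
  · rw [Set.indicator_of_mem hzt, Set.indicator_of_mem hzt]
    have h1 := (pathProb_pos hd P S τ).le
    split_ifs with hk
    · exact le_mul_of_one_le_right h1
        (one_le_potential hη hρ hgap hK hv _ (isProbVec_trun hd P S τ _) hk)
    · exact mul_nonneg h1 (potential_nonneg _ _)
  · rw [Set.indicator_of_notMem hzt, Set.indicator_of_notMem hzt, zero_mul]

/-- The event that all Laplace variables are of moderate size. -/
def moderateNoise (T : ℕ) (εhat c : ℝ) : Set ((Fin (T + 1) → ℝ) × (Fin T → ℝ)) :=
  {z | (∀ i, |z.1 i| ≤ 2 / εhat * c) ∧ ∀ t, |z.2 t| ≤ 4 / εhat * c}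

theorem measurableSet_moderateNoise (T : ℕ) (εhat c : ℝ) :
    MeasurableSet (moderateNoise T εhat c) := by
  have : moderateNoise T εhat c = (⋂ i, {z | |z.1 i| ≤ 2 / εhat * c}) ∩
      ⋂ t, {z | |z.2 t| ≤ 4 / εhat * c} := by
    ext z; simp [moderateNoise]
  rw [this]
  refine (MeasurableSet.iInter fun i => ?_).inter (MeasurableSet.iInter fun t => ?_)
  · exact measurableSet_le (f := fun z : (Fin (T + 1) → ℝ) × (Fin T → ℝ) => |z.1 i|)
      (by fun_prop) measurable_const
  · exact measurableSet_le (f := fun z : (Fin (T + 1) → ℝ) × (Fin T → ℝ) => |z.2 t|)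
      (by fun_prop) measurable_const

theorem moderateNoise_ge {εhat c : ℝ} (hε : 0 < εhat) (hc : 0 ≤ c) :
    1 - (2 * T + 1) * Real.exp (-c) ≤ (testLaw T εhat).real (moderateNoise T εhat c) := by
  have hlap := isProbabilityMeasure_laplace (b := 2 / εhat) (by positivity)
  have hlap' := isProbabilityMeasure_laplace (b := 4 / εhat) (by positivity)
  have hlaw := isProbabilityMeasure_testLaw (T := T) hε
  have hmeas : ∀ a : ℝ, MeasurableSet {x : ℝ | a < |x|} := fun a =>
    measurableSet_lt measurable_const (by fun_prop)
  have h1 : ∀ i, (testLaw T εhat).real {z | 2 / εhat * c < |z.1 i|} = Real.exp (-c) := by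
    intro i
    have h := ((measurePreserving_eval (fun _ : Fin (T + 1) => laplace (2 / εhat)) i).comp
      (measurePreserving_fst (ν := Measure.pi fun _ : Fin T => laplace (4 / εhat)))).measure_preimage
      (hmeas (2 / εhat * c)).nullMeasurableSet
    rw [laplace_abs_gt (by positivity) (by positivity), mul_div_cancel_left₀ _ (by positivity)] at h
    rw [measureReal_def]
    exact (congrArg ENNReal.toReal h).trans (ENNReal.toReal_ofReal (Real.exp_pos _).le)
  have h2 : ∀ t, (testLaw T εhat).real {z | 4 / εhat * c < |z.2 t|} = Real.exp (-c) := by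
    intro t
    have h := ((measurePreserving_eval (fun _ : Fin T => laplace (4 / εhat)) t).comp
      (measurePreserving_snd (μ := Measure.pi fun _ : Fin (T + 1) =>
        laplace (2 / εhat)))).measure_preimage (hmeas (4 / εhat * c)).nullMeasurableSet
    rw [laplace_abs_gt (by positivity) (by positivity), mul_div_cancel_left₀ _ (by positivity)] at h
    rw [measureReal_def]
    exact (congrArg ENNReal.toReal h).trans (ENNReal.toReal_ofReal (Real.exp_pos _).le)
  have h3 : (moderateNoise T εhat c)ᶜ ⊆ (⋃ i, {z | 2 / εhat * c < |z.1 i|}) ∪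
      ⋃ t, {z | 4 / εhat * c < |z.2 t|} := by
    intro z hz
    by_contra hcon
    simp only [Set.mem_union, Set.mem_iUnion, not_or, not_exists] at hcon
    exact hz ⟨fun i => not_lt.1 (hcon.1 i), fun t => not_lt.1 (hcon.2 t)⟩
  have h4 := (measureReal_mono (μ := testLaw T εhat) h3).trans (measureReal_union_le _ _)
  have h5 := measureReal_iUnion_fintype_le (μ := testLaw T εhat)
    fun i : Fin (T + 1) => {z : (Fin (T + 1) → ℝ) × (Fin T → ℝ) | 2 / εhat * c < |z.1 i|}
  have h6 := measureReal_iUnion_fintype_le (μ := testLaw T εhat)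
    fun t : Fin T => {z : (Fin (T + 1) → ℝ) × (Fin T → ℝ) | 4 / εhat * c < |z.2 t|}
  simp only [h1, h2, Finset.sum_const, Finset.card_univ, Fintype.card_fin, nsmul_eq_mul] at h5 h6
  push_cast at h5
  rw [probReal_compl_eq_one_sub (measurableSet_moderateNoise T εhat c)] at h4
  linarith

theorem k_le_of_le {τ : Transcript d T P.m} {t t' : Fin (T + 1)} (h : t ≤ t') :
    (trun P S τ t).k ≤ (trun P S τ t').k := by
  induction t' using Fin.induction with
  | zero => rw [le_antisymm h (Fin.zero_le _)]
  | succ r ih =>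
    rcases eq_or_lt_of_le h with rfl | hlt
    · exact le_rfl
    · refine (ih (Fin.le_castSucc_iff.2 hlt)).trans ?_
      rw [trun, trun, chain_succ]
      cases τ r with
      | none => exact le_rfl
      | some J => exact Nat.le_succ _

/-- With moderate noise, the number of errors is bounded as long as the budget of updates is
not exhausted. -/
theorem errors_le (hd : 0 < d) {c : ℝ} (hε : 0 < P.εhat) (hc : 0 ≤ c)
    (hL : P.L = 8 * c / P.εhat)
    {τ : Transcript d T P.m} {ω : Noise T P.m} (hω : ω ∈ noiseSet P S τ)
    (hz : (ω.thr, ω.query) ∈ moderateNoise T P.εhat c)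
    (hk : ((trun P S τ (Fin.last T)).k : ℝ) < P.K) :
    (errors P S ω : ℝ) ≤ (P.K + 1) * (14 * c / P.εhat + 1) := by
  classical
  have hB : 0 ≤ 14 * c / P.εhat := by positivity
  let n : Fin (T + 1) → ℕ := fun t => (Finset.univ.filter fun r : Fin T =>
    r.castSucc < t ∧ predict (trun P S τ r.castSucc).wt (S r).1 ≠ (S r).2).card
  have hn0 : n 0 = 0 := by simp [n]
  have hns : ∀ t : Fin T, n t.succ + (trun P S τ t.castSucc).cache.length =
      n t.castSucc + ((trun P S τ t.castSucc).newCache (S t)).length := by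
    intro t
    unfold TState.newCache
    split_ifs with hp
    · have : (Finset.univ.filter fun r : Fin T => r.castSucc < t.succ ∧
          predict (trun P S τ r.castSucc).wt (S r).1 ≠ (S r).2) =
          insert t (Finset.univ.filter fun r : Fin T => r.castSucc < t.castSucc ∧
          predict (trun P S τ r.castSucc).wt (S r).1 ≠ (S r).2) := by
        ext r
        simp only [Finset.mem_filter, Finset.mem_univ, true_and, Finset.mem_insert,
          Fin.castSucc_lt_succ_iff, Fin.castSucc_lt_castSucc_iff, le_iff_eq_or_lt]
        constructor
        · rintro ⟨h | h, h'⟩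
          · exact Or.inl h
          · exact Or.inr ⟨h, h'⟩
        · rintro (rfl | h)
          · exact ⟨Or.inl rfl, hp⟩
          · exact ⟨Or.inr h.1, h.2⟩
      simp only [n]
      rw [this, Finset.card_insert_of_notMem (by simp)]
      simp only [List.length_append, List.length_singleton]
      omega
    · have : (Finset.univ.filter fun r : Fin T => r.castSucc < t.succ ∧
          predict (trun P S τ r.castSucc).wt (S r).1 ≠ (S r).2) =
          (Finset.univ.filter fun r : Fin T => r.castSucc < t.castSucc ∧
          predict (trun P S τ r.castSucc).wt (S r).1 ≠ (S r).2) := by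
        ext r
        simp only [Finset.mem_filter, Finset.mem_univ, true_and,
          Fin.castSucc_lt_succ_iff, Fin.castSucc_lt_castSucc_iff, le_iff_eq_or_lt]
        constructor
        · rintro ⟨rfl | h, h'⟩
          · exact absurd h' hp
          · exact ⟨h, h'⟩
        · exact fun h => ⟨Or.inr h.1, h.2⟩
      simp only [n]
      rw [this]
  -- A negative test below the budget bounds the cache by `L` plus both noises, `(8 + 2 + 4) c /
  -- εhat`; the round of an update may add one more error.
  have hinv : ∀ t, (n t : ℝ) ≤ (trun P S τ t).cache.length +
      (trun P S τ t).k * (14 * c / P.εhat + 1) ∧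
      ((trun P S τ t).cache.length : ℝ) ≤ 14 * c / P.εhat := by
    intro t
    induction t using Fin.induction with
    | zero => simp [hn0, TState.init, hB]
    | succ t ih =>
      have hkt : ((trun P S τ t.castSucc).k : ℝ) < P.K :=
        lt_of_le_of_lt (by exact_mod_cast k_le_of_le (Fin.le_last _)) hk
      have ht : _ ↔ Test P S (ω.thr, ω.query) t (trun P S τ t.castSucc) := hω.1 t
      have hs : (n t.succ : ℝ) + (trun P S τ t.castSucc).cache.length =
        n t.castSucc + ((trun P S τ t.castSucc).newCache (S t)).length := by
        exact_mod_cast hns t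
      have hl : (((trun P S τ t.castSucc).newCache (S t)).length : ℝ) ≤
          (trun P S τ t.castSucc).cache.length + 1 := by
        exact_mod_cast length_newCache_le _ _
      rw [show trun P S τ t.succ = TState.next P S t (trun P S τ t.castSucc) (τ t) from rfl]
      generalize trun P S τ t.castSucc = s at *
      cases ho : τ t with
      | none =>
        rw [ho] at ht
        have ht' : ¬ Test P S (ω.thr, ω.query) t s := by simpa using ht
        have h1 : ((s.newCache (S t)).length : ℝ) + ω.query t < P.L + ω.thr s.ep := by
          by_contra hcon
          exact ht' ⟨not_lt.1 hcon, hkt⟩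
        have h2 := (abs_le.1 (hz.1 s.ep)).2
        have h3 := (abs_le.1 (hz.2 t)).1
        simp only at h2 h3
        have h4 : 14 * c / P.εhat = P.L + 2 / P.εhat * c + 4 / P.εhat * c := by
          rw [hL]; ring
        simp only [TState.next]
        exact ⟨by linarith [ih.1], by linarith⟩
      | some J =>
        simp only [TState.next, List.length_nil]
        push_cast
        exact ⟨by linarith [ih.1, ih.2], hB⟩
  have hst : ∀ r, hypotheses P S ω r = (trun P S τ r.castSucc).wt := fun r => by
    unfold hypotheses
    rw [stateAt_eq_trun hd hω]
    rfl
  have herr : errors P S ω = n (Fin.last T) := by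
    unfold errors
    simp only [n]
    congr 1
    ext r
    simp only [Finset.mem_filter, Finset.mem_univ, true_and, hst, Fin.castSucc_lt_last]
  rw [herr]
  have h := hinv (Fin.last T)
  have h2 := mul_le_mul_of_nonneg_right hk.le (by positivity : 0 ≤ 14 * c / P.εhat + 1)
  linarith [h.1, h.2]

/-- `L = 8c / εhat` exceeds the total noise `6c / εhat`, so a count of 0 cannot pass the test. -/
theorem newCache_ne_nil_of_test {c : ℝ} (hε : 0 < P.εhat) (hc : 0 < c)
    (hL : P.L = 8 * c / P.εhat) {z : (Fin (T + 1) → ℝ) × (Fin T → ℝ)}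
    (hz : z ∈ moderateNoise T P.εhat c) (t : Fin T) (s : TState d T)
    (h : Test P S z t s) : s.newCache (S t) ≠ [] := by
  intro hnil
  have h1 := h.1
  rw [hnil, List.length_nil, hL] at h1
  have h2 := (abs_le.1 (hz.1 s.ep)).1
  have h3 := (abs_le.1 (hz.2 t)).2
  have h4 : 8 * c / P.εhat = 2 / P.εhat * c + 4 / P.εhat * c + 2 * (c / P.εhat) := by ring
  have h5 : 0 < c / P.εhat := by positivity
  push_cast at h1
  linarith

/-- The error bound in terms of the parameters of the algorithm. -/
theorem le_noiseLaw_errors_le (hd : 0 < d) {ρ β : ℝ} (hη : 0 < P.η) (hε : 0 < P.εhat)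
    (hρ : 0 ≤ ρ) (hm : 0 < P.m) (hT : 1 ≤ T) (hβ : 0 < β) (hβ1 : β < 1)
    (hmρ : Real.log (2 * T / β) ≤ P.m * ρ ^ 2 / 8) (hKpos : 0 < P.K)
    (hgap : 0 < P.η * ρ - P.η ^ 2) (hK : P.K = 2 * Real.log d / (P.η * ρ - P.η ^ 2))
    (hL : P.L = 8 * Real.log (2 * T / β) / P.εhat)
    (hS : MarginConsistent ρ S) {B : ℝ}
    (hB : (P.K + 1) * (14 * Real.log (2 * T / β) / P.εhat + 1) ≤ B) :
    1 - 2 * β ≤ (noiseLaw T P.m P.εhat).real {ω | (errors P S ω : ℝ) ≤ B} := by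
  classical
  obtain ⟨v, hv, hv1, hvS⟩ := hS
  have hv1' : ∑ j, v j = 1 := by
    rw [← hv1]; exact Finset.sum_congr rfl fun j _ => (abs_of_nonneg (hv j)).symm
  have hT' : (1 : ℝ) ≤ T := by exact_mod_cast hT
  set c := Real.log (2 * T / β) with hcdef
  have harg : 1 < 2 * T / β := by rw [lt_div_iff₀ hβ]; linarith
  have hc : 0 < c := Real.log_pos harg
  have hexp : Real.exp (-c) = β / (2 * T) := by
    rw [Real.exp_neg, hcdef, Real.exp_log (by positivity), inv_div]
  have hTb : T * Real.exp (-(P.m * ρ ^ 2 / 8)) ≤ β / 2 := by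
    have : Real.exp (-(P.m * ρ ^ 2 / 8)) ≤ β / (2 * T) := by
      rw [← hexp]; exact Real.exp_le_exp.2 (neg_le_neg hmρ)
    calc T * Real.exp (-(P.m * ρ ^ 2 / 8)) ≤ T * (β / (2 * T)) :=
          mul_le_mul_of_nonneg_left this (by positivity)
      _ = β / 2 := by field_simp
  have hlaw := isProbabilityMeasure_testLaw (T := T) hε
  set G := moderateNoise T P.εhat c with hG
  have hGm : MeasurableSet G := measurableSet_moderateNoise T P.εhat c
  have hGp := moderateNoise_ge (T := T) hε hc.le
  have h1 := sum_measureReal_inter_mul_le (testLaw T P.εhat) (measurableSet_testSet P S) hGm _ _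
    fun z hz => sum_indicator_exhausted_le hd hη hρ hm (by linarith) hKpos hgap hK hv hv1' hvS
      (newCache_ne_nil_of_test hε hc hL hz)
  have h2 := sum_testLaw_inter_mul hd hε S hGm
  have h3 := sum_le_noiseLaw_real hd hε S hGm
    (Finset.univ.filter fun τ => ¬ P.K ≤ (trun P S τ (Fin.last T)).k)
    (X := {ω | (errors P S ω : ℝ) ≤ B}) fun τ hτ ω hω hz =>
      (errors_le hd hε hc.le hL hω hz (not_le.1 (Finset.mem_filter.1 hτ).2)).trans hB
  simp only [mul_ite, mul_zero] at h1
  rw [← Finset.sum_filter] at h1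
  rw [← Finset.sum_filter_add_sum_filter_not _
    (fun τ => P.K ≤ (trun P S τ (Fin.last T)).k)] at h2
  have h4 : T * Real.exp (-(P.m * ρ ^ 2 / 8)) * (testLaw T P.εhat).real G ≤ β / 2 := by
    refine (mul_le_of_le_one_right (by positivity) measureReal_le_one).trans hTb
  -- Large noise accounts for `3β/2`, exhaustion of the budget for `β/2`.
  have h5 : (2 * T + 1) * Real.exp (-c) ≤ 3 * β / 2 := by
    rw [hexp, mul_div_assoc', div_le_div_iff₀ (by positivity) (by norm_num)]
    nlinarith
  linarith

/-! ### The parameters -/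

theorem half_lt_log_two : 1 / 2 < Real.log 2 := by linarith [Real.log_two_gt_d9]

theorem log_le_two_mul_sqrt {y : ℝ} (hy : 0 < y) : Real.log y ≤ 2 * Real.sqrt y := by
  have h := Real.log_le_self (Real.sqrt_nonneg y)
  rw [Real.log_sqrt hy.le] at h
  linarith

theorem log_two_le_log_nat {d : ℕ} (hd : 2 ≤ d) : Real.log 2 ≤ Real.log d :=
  Real.log_le_log (by norm_num) (by exact_mod_cast hd)

theorem log_two_le_log_two_mul_div {T : ℕ} {β : ℝ} (hT : 1 ≤ T) (hβ : 0 < β) (hβ1 : β < 1) :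
    Real.log 2 ≤ Real.log (2 * T / β) := by
  have hT' : (1 : ℝ) ≤ T := by exact_mod_cast hT
  refine Real.log_le_log (by norm_num) ?_
  rw [le_div_iff₀ hβ]
  nlinarith

/-- The switching bound is bounded below. -/
theorem eight_mul_log_le {d : ℕ} {ρ η K : ℝ} (hd : 2 ≤ d) (hgap : 0 < η * ρ - η ^ 2)
    (hK : K = 2 * Real.log d / (η * ρ - η ^ 2)) : 8 * Real.log d ≤ K * ρ ^ 2 := by
  have h1 := half_lt_log_two.trans_le (log_two_le_log_nat hd)
  have h2 : K * (η * ρ - η ^ 2) = 2 * Real.log d := by rw [hK, div_mul_cancel₀ _ hgap.ne']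
  have hKpos : 0 < K := by rw [hK]; positivity
  -- The denominator `η (ρ - η)` is at most `ρ² / 4`.
  nlinarith [mul_nonneg hKpos.le (sq_nonneg (ρ - 2 * η))]

theorem one_le_log_four_mul_div {K δ : ℝ} (hK : 5 ≤ K) (hδ : 0 < δ) (hδ1 : δ < 1) :
    1 ≤ Real.log (4 * K / δ) := by
  rw [Real.le_log_iff_exp_le (by positivity)]
  have : 4 * K ≤ 4 * K / δ := by rw [le_div_iff₀ hδ]; nlinarith
  linarith [Real.exp_one_lt_d9]

theorem eta_eq_iff {η ε x : ℝ} (hη : 0 < η) (hε : 0 < ε) (hx : 0 < x) :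
    η = ε / (8 * Real.sqrt (2 * x)) ↔ 128 * η ^ 2 * x = ε ^ 2 := by
  have hs : 0 < Real.sqrt (2 * x) := Real.sqrt_pos.2 (by positivity)
  have hsq := Real.sq_sqrt (show 0 ≤ 2 * x by positivity)
  rw [eq_div_iff (by positivity), ← sq_eq_sq₀ (by positivity) hε.le]
  rw [show (η * (8 * Real.sqrt (2 * x))) ^ 2 = 64 * η ^ 2 * Real.sqrt (2 * x) ^ 2 by ring, hsq]
  rw [show 64 * η ^ 2 * (2 * x) = 128 * η ^ 2 * x by ring]

/-- Basic consequences of the equations for the parameters. -/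
structure ParamBounds (d T : ℕ) (ρ ε δ β : ℝ) (P : Params) : Prop where
  gap_pos : 0 < P.η * ρ - P.η ^ 2
  le_m : 8 * Real.log (2 * T / β) ≤ P.m * ρ ^ 2
  m_le : P.m * ρ ^ 2 ≤ 10 * Real.log (2 * T / β)
  m_pos : 0 < P.m
  five_le_K : 5 ≤ P.K
  one_le_log : 1 ≤ Real.log (4 * P.K / δ)
  eta_sq : 128 * P.η ^ 2 * (P.m * P.K * Real.log (4 * P.K / δ)) = ε ^ 2
  eta_le : P.η ≤ ρ / 2
  εhat_pos : 0 < P.εhat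
  εhat_le : P.εhat ≤ ε / 8

theorem ceil_bounds {Λ ρ : ℝ} (hΛ : 1 / 2 ≤ Λ) (hρ : 0 < ρ) (hρ1 : ρ ≤ 1) :
    8 * Λ ≤ ⌈8 * Λ / ρ ^ 2⌉₊ * ρ ^ 2 ∧ ⌈8 * Λ / ρ ^ 2⌉₊ * ρ ^ 2 ≤ 10 * Λ ∧
      0 < ⌈8 * Λ / ρ ^ 2⌉₊ := by
  have hρ2 : 0 < ρ ^ 2 := by positivity
  have h1 := Nat.le_ceil (8 * Λ / ρ ^ 2)
  have h2 := (Nat.ceil_lt_add_one (show 0 ≤ 8 * Λ / ρ ^ 2 by positivity)).le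
  rw [div_le_iff₀ hρ2] at h1
  refine ⟨h1, ?_, Nat.ceil_pos.2 (by positivity)⟩
  have h3 := mul_le_mul_of_nonneg_right h2 hρ2.le
  rw [add_mul, div_mul_cancel₀ _ hρ2.ne'] at h3
  nlinarith

theorem Admissible.bounds {d T : ℕ} {ρ ε δ β : ℝ} {P : Params}
    (h : Admissible d T ρ ε δ β P) (hd : 2 ≤ d) (hT : 1 ≤ T) (hρ : 0 < ρ) (hρ1 : ρ ≤ 1)
    (hε : 0 < ε) (hε1 : ε < 1) (hδ : 0 < δ) (hδ1 : δ < 1) (hβ : 0 < β) (hβ1 : β < 1) :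
    ParamBounds d T ρ ε δ β P := by
  have hl2 := Real.log_two_gt_d9
  have hld := log_two_le_log_nat hd
  have hΛ := log_two_le_log_two_mul_div hT hβ hβ1
  have hη := h.η_pos
  have hKpos := h.K_pos
  have hgap : 0 < P.η * ρ - P.η ^ 2 := by
    have := h.K_pos
    rw [h.K_eq] at this
    exact (pos_iff_pos_of_mul_pos (by
      rw [div_eq_mul_inv] at this
      have h2 : 0 < 2 * Real.log d := by linarith
      have h3 := (pos_iff_pos_of_mul_pos this).1 h2
      exact mul_pos h2 (inv_pos.1 h3))).1 (show 0 < 2 * Real.log d by linarith)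
  obtain ⟨hm1, hm2, hm3⟩ := ceil_bounds (show 1 / 2 ≤ Real.log (2 * T / β) by linarith) hρ hρ1
  rw [← h.m_eq] at hm1 hm2 hm3
  have hK8 := eight_mul_log_le hd hgap h.K_eq
  have hK5 : 5 ≤ P.K := by
    have : P.K * ρ ^ 2 ≤ P.K * 1 := mul_le_mul_of_nonneg_left (by nlinarith) hKpos.le
    linarith
  have hl := one_le_log_four_mul_div hK5 hδ hδ1
  have hmpos : (0 : ℝ) < P.m := by exact_mod_cast hm3
  have hsq : 128 * P.η ^ 2 * (P.m * P.K * Real.log (4 * P.K / δ)) = ε ^ 2 := by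
    rw [← eta_eq_iff hη hε (by positivity)]
    refine h.η_eq.trans ?_
    rw [← mul_assoc, ← mul_assoc]
  have hD : Real.log 2 ≤ Real.log (2 / δ) := Real.log_le_log (by norm_num) (by
    rw [le_div_iff₀ hδ]; linarith)
  have hs : 2 ≤ Real.sqrt (2 * P.K * Real.log (2 / δ)) := by
    have hD0 : 0 < Real.log (2 / δ) := by linarith
    rw [Real.le_sqrt (by norm_num) (by positivity)]
    nlinarith
  refine ⟨hgap, hm1, hm2, hm3, hK5, hl, hsq, ?_, ?_, ?_⟩
  -- If `η > ρ/2`, then `η² m ≥ 1`, and `eta_sq` would force `ε² ≥ 640`.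
  · by_contra hcon
    have hcon := not_le.1 hcon
    have h1 : ρ ^ 2 / 4 ≤ P.η ^ 2 := by nlinarith
    have h2 : 1 ≤ P.η ^ 2 * P.m := by nlinarith
    have h3 : 5 ≤ P.K * Real.log (4 * P.K / δ) := by nlinarith
    have h4 : 5 ≤ P.η ^ 2 * P.m * (P.K * Real.log (4 * P.K / δ)) := by nlinarith
    nlinarith
  · rw [h.εhat_eq]
    have : 0 < Real.sqrt (2 * P.K * Real.log (2 / δ)) := by linarith
    positivity
  · rw [h.εhat_eq]
    exact div_le_div_of_nonneg_left hε.le (by norm_num) (by linarith)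

/-- The parameters exist. -/
theorem exists_admissible {d T : ℕ} {ρ ε δ β : ℝ} (hd : 2 ≤ d) (hT : 1 ≤ T) (hρ : 0 < ρ)
    (hρ1 : ρ ≤ 1) (hε : 0 < ε) (hε1 : ε < 1) (hδ : 0 < δ) (hδ1 : δ < 1) (hβ : 0 < β)
    (hβ1 : β < 1) : ∃ P : Params, Admissible d T ρ ε δ β P := by
  have hl2 := Real.log_two_gt_d9
  have hld := log_two_le_log_nat hd
  have hΛ := log_two_le_log_two_mul_div hT hβ hβ1
  obtain ⟨hm1, -, hm3⟩ := ceil_bounds (show 1 / 2 ≤ Real.log (2 * T / β) by linarith) hρ hρ1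
  set m := ⌈8 * Real.log (2 * T / β) / ρ ^ 2⌉₊ with hm
  have hmpos : (0 : ℝ) < m := by exact_mod_cast hm3
  have hldpos : 0 < Real.log d := by linarith
  let K : ℝ → ℝ := fun η => 2 * Real.log d / (η * ρ - η ^ 2)
  let h : ℝ → ℝ := fun η => 128 * η ^ 2 * (m * K η * Real.log (4 * K η / δ))
  have hgap : ∀ η, 0 < η → η ≤ ρ / 2 → 0 < η * ρ - η ^ 2 := fun η h0 h1 => by nlinarith
  have hKpos : ∀ η, 0 < η → η ≤ ρ / 2 → 0 < K η := fun η h0 h1 =>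
    div_pos (by linarith) (hgap η h0 h1)
  have hK5 : ∀ η, 0 < η → η ≤ ρ / 2 → 5 ≤ K η := fun η h0 h1 => by
    have h2 := eight_mul_log_le hd (hgap η h0 h1) (K := K η) rfl
    have : K η * ρ ^ 2 ≤ K η * 1 := mul_le_mul_of_nonneg_left (by nlinarith) (hKpos η h0 h1).le
    linarith
  set A := 4 * Real.log d / ρ with hA
  have hApos : 0 < A := by positivity
  have hηK : ∀ η, 0 < η → η ≤ ρ / 2 → η * K η ≤ A := fun η h0 h1 => by
    rw [hA, ← mul_div_assoc, div_le_div_iff₀ (hgap η h0 h1) hρ]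
    nlinarith [mul_nonneg (mul_nonneg hldpos.le h0.le) (show 0 ≤ ρ - 2 * η by linarith)]
  -- From `log y ≤ 2 √y` and `η K ≤ A`, the square of `h a` is at most `(256 m)² · 4A³ / δ · a`; the
  -- second entry makes this at most `ε⁴`.
  set a := min (ρ / 2) (ε ^ 4 * δ / ((256 * m) ^ 2 * (4 * A ^ 3))) with ha
  have hapos : 0 < a := lt_min (by positivity) (by positivity)
  have haρ : a ≤ ρ / 2 := min_le_left _ _
  have hlow : h a ≤ ε ^ 2 := by
    have hKa := hKpos a hapos haρ
    have hy : 0 < 4 * K a / δ := by positivity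
    have h1 : h a ≤ 256 * m * (a ^ 2 * K a * Real.sqrt (4 * K a / δ)) := by
      have := mul_le_mul_of_nonneg_left (log_le_two_mul_sqrt hy)
        (show 0 ≤ 128 * a ^ 2 * (m * K a) by positivity)
      simp only [h]
      linarith
    refine h1.trans (abs_le_of_sq_le_sq' ?_ (by positivity)).2
    have h2 : (256 * m * (a ^ 2 * K a * Real.sqrt (4 * K a / δ))) ^ 2 =
        (256 * m) ^ 2 * (4 * (a * K a) ^ 3) / δ * a := by
      rw [mul_pow, mul_pow (a ^ 2 * K a), Real.sq_sqrt hy.le]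
      ring
    rw [h2]
    have h3 : (a * K a) ^ 3 ≤ A ^ 3 := pow_le_pow_left₀ (by positivity) (hηK a hapos haρ) 3
    calc (256 * m) ^ 2 * (4 * (a * K a) ^ 3) / δ * a
        ≤ (256 * m) ^ 2 * (4 * A ^ 3) / δ * (ε ^ 4 * δ / ((256 * m) ^ 2 * (4 * A ^ 3))) := by
          refine mul_le_mul ?_ (min_le_right _ _) hapos.le (by positivity)
          gcongr
      _ = (ε ^ 2) ^ 2 := by field_simp
  have hhigh : ε ^ 2 ≤ h (ρ / 2) := by
    have hρ2 : 0 < ρ / 2 := by positivity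
    have hk5 := hK5 (ρ / 2) hρ2 le_rfl
    have hl := one_le_log_four_mul_div hk5 hδ hδ1
    have h3 : 5 ≤ K (ρ / 2) * Real.log (4 * K (ρ / 2) / δ) := by nlinarith
    have h5 : 1 ≤ (ρ / 2) ^ 2 * m := by nlinarith
    have h4 : 5 ≤ (ρ / 2) ^ 2 * m * (K (ρ / 2) * Real.log (4 * K (ρ / 2) / δ)) := by nlinarith
    have h6 : h (ρ / 2) = 128 * ((ρ / 2) ^ 2 * m * (K (ρ / 2) * Real.log (4 * K (ρ / 2) / δ))) := by
      simp only [h]; ring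
    rw [h6]
    nlinarith
  have hcont : ContinuousOn h (Set.Icc a (ρ / 2)) := by
    have hKc : ContinuousOn K (Set.Icc a (ρ / 2)) := by
      refine ContinuousOn.div (by fun_prop) (by fun_prop) fun η hη => ?_
      exact (hgap η (hapos.trans_le hη.1) hη.2).ne'
    refine ContinuousOn.mul (by fun_prop) ((continuousOn_const.mul hKc).mul
      (ContinuousOn.log (by fun_prop) fun η hη => ?_))
    have := hKpos η (hapos.trans_le hη.1) hη.2
    positivity
  obtain ⟨η, hη, heq⟩ := intermediate_value_Icc haρ hcont ⟨hlow, hhigh⟩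
  have hη0 := hapos.trans_le hη.1
  have hk := hKpos η hη0 hη.2
  have hl := one_le_log_four_mul_div (hK5 η hη0 hη.2) hδ hδ1
  let εh := ε / (4 * Real.sqrt (2 * K η * Real.log (2 / δ)))
  refine ⟨⟨εh, η, 8 * Real.log (2 * T / β) / εh, m, K η⟩, hk, hη0, rfl, rfl, ?_, rfl, rfl⟩
  have := (eta_eq_iff hη0 hε (by positivity)).2 heq
  simp only
  rw [mul_assoc, mul_assoc, ← mul_assoc (m : ℝ)]
  exact this

/-- The privacy exponent is small enough. -/
theorem ParamBounds.exp_le {d T : ℕ} {ρ ε δ β : ℝ} {P : Params}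
    (h : ParamBounds d T ρ ε δ β P) (hε : 0 < ε) (hε1 : ε < 1) (hδ : 0 < δ) :
    Real.exp (P.εhat - 10 * Real.log (4 * P.K / δ) / ε * (ε - P.εhat) +
      2 * P.η ^ 2 * (10 * Real.log (4 * P.K / δ) / ε) *
        (10 * Real.log (4 * P.K / δ) / ε + 1) * P.m * (⌈P.K⌉₊ : ℝ)) ≤ δ := by
  have hl := h.one_le_log
  have hK := h.five_le_K
  set l := Real.log (4 * P.K / δ) with hldef
  have hKpos : 0 < P.K := by linarith
  have hN : (⌈P.K⌉₊ : ℝ) ≤ 6 / 5 * P.K := by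
    have := (Nat.ceil_lt_add_one hKpos.le).le
    linarith
  -- Rounding up costs a factor 6/5, and `100 · 6/5 = 120` is below the 128 of `eta_sq`.
  have hq : 2 * P.η ^ 2 * P.m * (⌈P.K⌉₊ : ℝ) ≤ ε ^ 2 / (50 * l) := by
    rw [le_div_iff₀ (by positivity), ← h.eta_sq]
    have h1 := mul_le_mul_of_nonneg_left hN (show 0 ≤ 100 * P.η ^ 2 * P.m * l by positivity)
    have h2 : 0 ≤ P.η ^ 2 * P.m * l * P.K := by positivity
    linarith
  have h1 : 2 * P.η ^ 2 * (10 * l / ε) * (10 * l / ε + 1) * P.m * (⌈P.K⌉₊ : ℝ) ≤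
      2 * l + ε / 5 := by
    calc 2 * P.η ^ 2 * (10 * l / ε) * (10 * l / ε + 1) * P.m * (⌈P.K⌉₊ : ℝ)
        = 2 * P.η ^ 2 * P.m * (⌈P.K⌉₊ : ℝ) * ((10 * l / ε) * (10 * l / ε + 1)) := by ring
      _ ≤ ε ^ 2 / (50 * l) * ((10 * l / ε) * (10 * l / ε + 1)) :=
          mul_le_mul_of_nonneg_right hq (by positivity)
      _ = 2 * l + ε / 5 := by field_simp; ring
  have h2 : 35 / 4 * l ≤ 10 * l / ε * (ε - P.εhat) := by
    have h3 : 7 / 8 * ε ≤ ε - P.εhat := by linarith [h.εhat_le]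
    calc 35 / 4 * l = 10 * l / ε * (7 / 8 * ε) := by field_simp; norm_num
      _ ≤ _ := mul_le_mul_of_nonneg_left h3 (by positivity)
  have h3 : Real.exp (-l) = δ / (4 * P.K) := by
    rw [Real.exp_neg, hldef, Real.exp_log (by positivity), inv_div]
  calc _ ≤ Real.exp (-l) := Real.exp_le_exp.2 (by linarith [h.εhat_le])
    _ = δ / (4 * P.K) := h3
    _ ≤ δ := div_le_self hδ.le (by linarith)

/-! ### The order of magnitude of the error bound -/

theorem mainTerm_eq {d T : ℕ} {ρ ε δ β : ℝ} (hlam : 0 < Real.log (T / β)) :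
    mainTerm d T ρ ε δ β = Real.log d ^ 3 * (Real.log (T / β) ^ 2 * Real.sqrt (Real.log (T / β))) *
      Real.log (2 / δ) ^ 2 / (ε ^ 4 * ρ ^ 6) := by
  unfold mainTerm
  rw [show (5 / 2 : ℝ) = 2 + 1 / 2 by norm_num, Real.rpow_add hlam, Real.sqrt_eq_rpow]
  norm_cast

/-- The logarithm of a quantity that is bounded by a multiple of its own logarithm. -/
theorem log_four_mul_div_le {K G δ c : ℝ} (hK : 0 < K) (hG : 0 < G) (hδ : 0 < δ) (hc : 0 < c)
    (h : K ≤ c * G * Real.log (4 * K / δ)) :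
    Real.log (4 * K / δ) ≤ 2 * (Real.log (8 * c) + Real.log G + Real.log (1 / δ)) := by
  have hy : 0 < 4 * K / δ := by positivity
  have hs := Real.sqrt_pos.2 hy
  have hsq := Real.sq_sqrt hy.le
  -- Bounding the logarithm by a square root makes `y = 4K/δ` at most a multiple of `√y`; dividing
  -- by `√y` resolves the self-reference.
  have h1 : Real.sqrt (4 * K / δ) ≤ 8 * c * G * (1 / δ) := by
    have h2 := mul_le_mul_of_nonneg_left (log_le_two_mul_sqrt hy)
      (show 0 ≤ c * G by positivity)
    have h3 : 4 * K / δ ≤ 8 * c * G * (1 / δ) * Real.sqrt (4 * K / δ) := by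
      rw [div_le_iff₀ hδ]
      have : 8 * c * G * (1 / δ) * Real.sqrt (4 * K / δ) * δ =
        8 * c * G * Real.sqrt (4 * K / δ) := by field_simp
      rw [this]
      linarith
    nlinarith
  have h2 := Real.log_le_log hs h1
  rw [Real.log_mul (by positivity) (by positivity), Real.log_mul (by positivity) hG.ne',
    Real.log_sqrt hy.le] at h2
  linarith

/-- Since `η ≤ ρ/2`, `K η ρ ≤ 4 log d`. Squaring and eliminating `η²` by `eta_sq` leaves `K` bounded
by its own logarithm. -/
theorem ParamBounds.K_le {d T : ℕ} {ρ ε δ β : ℝ} {P : Params}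
    (h : ParamBounds d T ρ ε δ β P) (hη : 0 < P.η)
    (hKeq : P.K = 2 * Real.log d / (P.η * ρ - P.η ^ 2)) (hd : 2 ≤ d) (hρ : 0 < ρ) (hε : 0 < ε)
    {lam : ℝ} (hlam : Real.log (2 * T / β) ≤ 2 * lam) :
    P.K ≤ 40960 * (Real.log d ^ 2 * lam / (ε ^ 2 * ρ ^ 4)) * Real.log (4 * P.K / δ) := by
  have hApos : 0 < Real.log d :=
    (by linarith [half_lt_log_two] : 0 < Real.log 2).trans_le (log_two_le_log_nat hd)
  have hl := h.one_le_log
  have hKpos : 0 < P.K := by linarith [h.five_le_K]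
  have h3 := h.eta_sq
  set A := Real.log d
  set l := Real.log (4 * P.K / δ)
  have h1 : P.K * (P.η * ρ) ≤ 4 * A := by
    rw [hKeq, div_mul_eq_mul_div, div_le_iff₀ h.gap_pos]
    have := mul_nonneg (mul_nonneg hApos.le hη.le) (sub_nonneg.2 h.eta_le)
    linarith
  have h2 : (P.K * (P.η * ρ)) ^ 2 ≤ (4 * A) ^ 2 := pow_le_pow_left₀ (by positivity) h1 2
  have h4 : P.K * (ε ^ 2 * ρ ^ 4) ≤ 2048 * A ^ 2 * (P.m * ρ ^ 2) * l := by
    have e : P.K * (P.K * (ε ^ 2 * ρ ^ 4)) =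
        P.K * (128 * (P.m * ρ ^ 2) * l * (P.K * (P.η * ρ)) ^ 2) := by
      rw [← h3]; ring
    rw [mul_left_cancel₀ hKpos.ne' e]
    have := mul_le_mul_of_nonneg_left h2 (show 0 ≤ 128 * (P.m * ρ ^ 2) * l by positivity)
    linarith
  have h5 : P.m * ρ ^ 2 ≤ 20 * lam := by linarith [h.m_le]
  rw [← mul_div_assoc, div_mul_eq_mul_div, le_div_iff₀ (by positivity)]
  have := mul_le_mul_of_nonneg_left h5 (show 0 ≤ 2048 * A ^ 2 * l by positivity)
  linarith

theorem one_div_le_mul_mul_sq {a b c : ℝ} (ha : 1 / 2 ≤ a) (hb : 1 / 2 ≤ b) (hc : 1 / 2 ≤ c) :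
    1 / 32 ≤ a * (b * Real.sqrt b) * c ^ 2 := by
  have h1 : 1 / 2 ≤ Real.sqrt b := Real.le_sqrt_of_sq_le (by norm_num; linarith)
  calc (1 / 32 : ℝ) = 1 / 2 * (1 / 2 * (1 / 2)) * (1 / 2) ^ 2 := by norm_num
    _ ≤ a * (b * Real.sqrt b) * c ^ 2 := by gcongr

/-- The budget is of order `K √(K D) lam / ε`. With `K` of order at most `G F D` and `f = G^(3/2) D²
lam / ε`, this is at most a multiple of `f F^(3/2)`, and `F^(3/2)` is absorbed by `F²` because `F >
1/2`. -/
theorem budget_le_mainTerm {d T : ℕ} {ρ ε δ β : ℝ} {P : Params}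
    (h : ParamBounds d T ρ ε δ β P) (hη : 0 < P.η)
    (hKeq : P.K = 2 * Real.log d / (P.η * ρ - P.η ^ 2))
    (hεh : P.εhat = ε / (4 * Real.sqrt (2 * P.K * Real.log (2 / δ))))
    (hd : 2 ≤ d) (hT : 1 ≤ T) (hρ : 0 < ρ) (hρ1 : ρ ≤ 1)
    (hε : 0 < ε) (hε1 : ε < 1) (hδ : 0 < δ) (hδ1 : δ < 1) (hβ : 0 < β) (hβ1 : β < 1 / 2) :
    (P.K + 1) * (14 * Real.log (2 * T / β) / P.εhat + 1) ≤
      10 ^ 13 * mainTerm d T ρ ε δ β * Real.log (2 + mainTerm d T ρ ε δ β) ^ 2 := by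
  have hT' : (1 : ℝ) ≤ T := by exact_mod_cast hT
  have hl2 := half_lt_log_two
  have hA : 1 / 2 < Real.log d := hl2.trans_le (log_two_le_log_nat hd)
  have hlam : 1 / 2 < Real.log (T / β) := hl2.trans_le (Real.log_le_log (by norm_num) (by
    rw [le_div_iff₀ hβ]; linarith))
  have hD : 1 / 2 < Real.log (2 / δ) := hl2.trans_le (Real.log_le_log (by norm_num) (by
    rw [le_div_iff₀ hδ]; linarith))
  have hΛ : Real.log (2 * T / β) ≤ 2 * Real.log (T / β) := by
    have h1 : Real.log 2 ≤ Real.log (T / β) := Real.log_le_log (by norm_num) (by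
      rw [le_div_iff₀ hβ]; linarith)
    rw [mul_div_assoc, Real.log_mul (by norm_num) (by positivity)]
    linarith
  have hΛ2 : 1 / 2 < Real.log (2 * T / β) :=
    hl2.trans_le (log_two_le_log_two_mul_div hT hβ (by linarith))
  have hl := h.one_le_log
  have hK5 := h.five_le_K
  have hKpos : 0 < P.K := by linarith
  have hf := mainTerm_eq (d := d) (ρ := ρ) (ε := ε) (δ := δ)
    (show 0 < Real.log (T / β) by linarith)
  have hlogδ : Real.log (1 / δ) ≤ Real.log (2 / δ) :=
    Real.log_le_log (by positivity) (by gcongr; norm_num)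
  set f := mainTerm d T ρ ε δ β
  set A := Real.log d
  set lam := Real.log (T / β)
  set D := Real.log (2 / δ)
  set Λ := Real.log (2 * T / β)
  set l := Real.log (4 * P.K / δ) with hldef
  set G := A ^ 2 * lam / (ε ^ 2 * ρ ^ 4) with hG
  have hApos : 0 < A := by linarith
  have hlampos : 0 < lam := by linarith
  have hDpos : 0 < D := by linarith
  have hGpos : 0 < G := by positivity
  have hsl : 0 < Real.sqrt lam := Real.sqrt_pos.2 hlampos
  have hfpos : 0 < f := by rw [hf]; positivity
  have hF : 1 / 2 < Real.log (2 + f) :=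
    hl2.trans_le (Real.log_le_log (by norm_num) (by linarith))
  set F := Real.log (2 + f) with hFdef
  have hfG : f = G * (A * (lam * Real.sqrt lam) * D ^ 2 / (ε ^ 2 * ρ ^ 2)) := by
    rw [hf, hG]; field_simp
  have hGf : G ≤ 32 * (2 + f) := by
    have h5 := one_div_le_mul_mul_sq hA.le hlam.le hD.le
    have h6 : ε ^ 2 * ρ ^ 2 ≤ 1 := by
      rw [← mul_pow]; exact pow_le_one₀ (by positivity) (mul_le_one₀ hε1.le hρ.le hρ1)
    have h7 : 1 / 32 ≤ A * (lam * Real.sqrt lam) * D ^ 2 / (ε ^ 2 * ρ ^ 2) := by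
      rw [le_div_iff₀ (by positivity)]
      linarith
    have h8 := mul_le_mul_of_nonneg_left h7 hGpos.le
    rw [← hfG] at h8
    linarith
  have hK : P.K ≤ 40960 * G * l := h.K_le hη hKeq hd hρ hε hΛ
  have hl3 : l ≤ 104 * (F * D) := by
    have h1 := log_four_mul_div_le hKpos hGpos hδ (by norm_num) hK
    rw [← hldef] at h1
    have h2 : Real.log G ≤ Real.log 32 + F := by
      rw [hFdef, ← Real.log_mul (by norm_num) (by positivity)]
      exact Real.log_le_log hGpos hGf
    have h3 : Real.log (8 * 40960) + Real.log 32 ≤ 24 * Real.log 2 := by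
      rw [← Real.log_mul (by norm_num) (by norm_num), ← Real.log_rpow (by norm_num)]
      exact Real.log_le_log (by norm_num) (by norm_num)
    have h4 : Real.log 2 ≤ F := Real.log_le_log (by norm_num) (by linarith)
    have h5 := mul_le_mul_of_nonneg_left hD.le (by linarith : 0 ≤ F)
    have h6 := mul_le_mul_of_nonneg_right hF.le hDpos.le
    have h7 : l ≤ 2 * (Real.log (8 * 40960) + (Real.log 32 + F) + D) :=
      h1.trans (mul_le_mul_of_nonneg_left (add_le_add (add_le_add le_rfl h2) hlogδ) (by norm_num))
    have h8 : Real.log (8 * 40960) + Real.log 32 ≤ 24 * F := by linarith only [h3, h4]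
    linarith only [h5, h6, h7, h8]
  have hK2 : P.K ≤ 4259840 * (G * F * D) := by
    have := mul_le_mul_of_nonneg_left hl3 (show 0 ≤ 40960 * G by positivity)
    linarith
  have hsG : Real.sqrt G = A * Real.sqrt lam / (ε * ρ ^ 2) := by
    rw [hG, Real.sqrt_div (by positivity), Real.sqrt_mul (by positivity),
      Real.sqrt_sq hApos.le, show ε ^ 2 * ρ ^ 4 = (ε * ρ ^ 2) ^ 2 by ring,
      Real.sqrt_sq (by positivity)]
  have hs : Real.sqrt (2 * P.K * D) ≤ 3000 * D * Real.sqrt G * (2 * F) := by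
    rw [Real.sqrt_le_left (by positivity)]
    have h1 : (3000 * D * Real.sqrt G * (2 * F)) ^ 2 = 36000000 * D ^ 2 * G * F ^ 2 := by
      rw [show (3000 * D * Real.sqrt G * (2 * F)) ^ 2 =
        36000000 * D ^ 2 * Real.sqrt G ^ 2 * F ^ 2 by ring, Real.sq_sqrt hGpos.le]
    rw [h1]
    have h2 := mul_le_mul_of_nonneg_right hK2 (show 0 ≤ 2 * D by positivity)
    have h3 : 0 ≤ G * D ^ 2 * F * (F - 1 / 2) :=
      mul_nonneg (by positivity) (by linarith)
    have h4 : 0 ≤ G * D ^ 2 * F := by positivity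
    linarith
  have hεhpos := h.εhat_pos
  have hε8 := h.εhat_le
  have hfirst : (P.K + 1) * (14 * Λ / P.εhat + 1) ≤ 6 / 5 * P.K * (32 * lam / P.εhat) := by
    refine mul_le_mul (by linarith) ?_ (by positivity) (by positivity)
    rw [div_add_one hεhpos.ne', div_le_div_iff_of_pos_right hεhpos]
    linarith
  have hinv : 1 / P.εhat = 4 * Real.sqrt (2 * P.K * D) / ε := by
    rw [hεh, one_div_div]
  have hgoal : 6 / 5 * P.K * (32 * lam / P.εhat) =
      (6 / 5 * 128) * (P.K * Real.sqrt (2 * P.K * D)) * (lam / ε) := by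
    rw [show 32 * lam / P.εhat = 32 * lam * (1 / P.εhat) by ring, hinv]
    ring
  rw [hgoal] at hfirst
  refine hfirst.trans ?_
  have hprod : P.K * Real.sqrt (2 * P.K * D) ≤
      4259840 * (G * F * D) * (3000 * D * Real.sqrt G * (2 * F)) :=
    mul_le_mul hK2 hs (Real.sqrt_nonneg _) (by positivity)
  have hff : G * Real.sqrt G * D ^ 2 * (lam / ε) = f := by
    rw [hf, hsG, hG]; field_simp
  calc (6 / 5 * 128) * (P.K * Real.sqrt (2 * P.K * D)) * (lam / ε)
      ≤ (6 / 5 * 128) * (4259840 * (G * F * D) * (3000 * D * Real.sqrt G * (2 * F))) *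
        (lam / ε) := by gcongr
    _ = (6 / 5 * 128 * 4259840 * 6000) * (G * Real.sqrt G * D ^ 2 * (lam / ε)) * F ^ 2 := by ring
    _ = (6 / 5 * 128 * 4259840 * 6000) * f * F ^ 2 := by rw [hff]
    _ ≤ _ := by
      refine mul_le_mul_of_nonneg_right ?_ (sq_nonneg F)
      exact mul_le_mul_of_nonneg_right (by norm_num) hfpos.le

end DPWinnow

end

theorem mainTheorem2 :
    ∃ (C : ℝ) (p : ℕ), 0 < C ∧
      ∀ (d T : ℕ) (ρ ε δ β : ℝ), 2 ≤ d → 1 ≤ T → 0 < ρ → ρ ≤ 1 → 0 < ε → ε < 1 →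
        0 < δ → δ < 1 → 0 < β → β < 1 →
        (∃ P : DPWinnow.Params, DPWinnow.Admissible d T ρ ε δ β P) ∧
        ∀ P : DPWinnow.Params, DPWinnow.Admissible d T ρ ε δ β P →
          DPWinnow.IsDP (DPWinnow.noiseLaw T P.m P.εhat) ε δ
            (fun (S : Fin T → DPWinnow.Example d) ω => DPWinnow.hypotheses P S ω) ∧
          ∀ S : Fin T → DPWinnow.Example d, DPWinnow.MarginConsistent ρ S →
            1 - 2 * β ≤ (DPWinnow.noiseLaw T P.m P.εhat).real
              {ω | (DPWinnow.errors P S ω : ℝ) ≤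
                C * DPWinnow.mainTerm d T ρ ε δ β *
                  Real.log (2 + DPWinnow.mainTerm d T ρ ε δ β) ^ p} := by
  refine ⟨10 ^ 13, 2, by norm_num, fun d T ρ ε δ β hd hT hρ hρ1 hε hε1 hδ hδ1 hβ hβ1 =>
    ⟨DPWinnow.exists_admissible hd hT hρ hρ1 hε hε1 hδ hδ1 hβ hβ1, fun P hP => ?_⟩⟩
  have h := hP.bounds hd hT hρ hρ1 hε hε1 hδ hδ1 hβ hβ1
  have hd0 : 0 < d := by omega
  have hl := h.one_le_log
  refine ⟨?_, fun S hS => ?_⟩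
  -- The tests use `εhat` of the privacy budget and the samples the remaining `ε - εhat`.
  · refine DPWinnow.isDP_hypotheses hd0 h.εhat_pos (N := ⌈P.K⌉₊)
      (fun k hk => Nat.lt_ceil.2 hk) (l := 10 * Real.log (4 * P.K / δ) / ε)
      (ε₁ := ε - P.εhat) (by positivity) (by linarith) (h.exp_le hε hε1 hδ)
  -- For `β ≥ 1/2` the probability bound is vacuous; below, `T/β > 2` keeps `log (T/β)` away from 0.
  · rcases lt_or_ge β (1 / 2) with hβ2 | hβ2
    · exact DPWinnow.le_noiseLaw_errors_le hd0 hP.η_pos h.εhat_pos hρ.le h.m_pos hT hβ hβ1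
        (by linarith [h.le_m]) hP.K_pos h.gap_pos hP.K_eq hP.L_eq hS
        (DPWinnow.budget_le_mainTerm h hP.η_pos hP.K_eq hP.εhat_eq hd hT hρ hρ1 hε hε1 hδ hδ1
          hβ hβ2)
    · exact le_trans (by linarith) MeasureTheory.measureReal_nonneg
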